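/- There is a universal constant $C>0$ such that the following holds. Let $m\ge 1$ and $k\ge 0$ be integers, $\nu,\rho,c>0$ and $p\in(0,1)$. Let $A,B$ be probability distributions on $\mathbb R$ such that $|\mathbb E_{x\sim A}[x^t]-\mathbb E_{x\sim N(0,1)}[x^t]|\le\nu$ and $|\mathbb E_{x\sim B}[x^t]-\mathbb E_{x\sim N(0,1)}[x^t]|\le\nu$ for all integers $1\le t\le k$, and such that $\chi^2(A,N(0,1))$ and $\chi^2(B,N(0,1))$ are finite, where $\chi^2(P,Q)=\int (dP/dQ)^2\,dQ-1$ (and $\chi^2(P,Q)=\infty$ if $P$ is not absolutely continuous with respect to $Q$). Put $\alpha=\chi^2(A,N(0,1))+\chi^2(B,N(0,1))$, assume $\nu^2+\alpha c^k\le\rho$, and put $$N=2^{C c^2 m}\cdot\frac{\rho}{\alpha}\qquad(N=\infty\text{ if }\alpha=0).$$ For a unit vector $v\in\mathbb R^m$ let $D_v^{A,B,p}$ be the distribution of the pair $(x,y)\in\mathbb R^m\times\{-1,1\}$ drawn as follows: with probability $p$, $y=1$ and $x$ is distributed as $A$ in the direction $v$ and, independently, as a standard Gaussian in the orthogonal complement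 of $v$; with probability $1-p$, $y=-1$ and $x$ is distributed in the same way with $B$ in place of $A$. A statistical query (SQ) algorithm may adaptively ask queries $(f,\tau)$, with $f:\mathbb R^m\times\{-1,1\}\to[-1,1]$ measurable and accuracy $\tau>0$; for the underlying distribution $D$, an oracle answers $(f,\tau)$ by some real number within $\tau$ of $\mathbb E_{D}[f]$. After finitely many queries the algorithm outputs a measurable hypothesis $h:\mathbb R^m\to\{-1,1\}$. The algorithm may be randomized. Suppose that an SQ algorithm has the following property: for every unit vector $v\in\mathbb R^m$ (unknown to the algorithm) and every valid oracle for $D_v^{A,B,p}$, it outputs, with probability at least $2/3$ over its internal randomness (a deterministic algorithm: always), a hypothesis $h$ with $$\mathbb P_{(x,y)\sim D_v^{A,B,p}}[h(x)\ne y]<\min\{p,1-p\}-4\sqrt\rho .$$ If $N\ge 1$, then the algorithm, in some run on some $D_v^{A,B,p}$ with a valid oracle, makes a query of accuracy $\tau<2\sqrt\rho$, or in some such run makes at least $N$ queries. -/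

import Mathlib

open MeasureTheory ProbabilityTheory
open scoped ENNReal

noncomputable section

/-- The chi-square divergence `χ²(A, B) = ∫ (dA/dB)² dB - 1` (equal to `∫ A(x)² / B(x) dx - 1` for
densities), with the value `∞` when `A` is not absolutely continuous with respect to `B`.
For probability measures the integral is at least `1`, so the subtraction is not truncated. -/
def chiSqDiv {X : Type*} [MeasurableSpace X] (A B : Measure X) : ℝ≥0∞ :=
  open Classical in
  if A ≪ B then (∫⁻ x, A.rnDeriv B x ^ 2 ∂B) - 1 else ∞

/-- The first `k` moments of `A` agree with those of `N(0,1)` up to additive error `ν`. -/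
def MatchesGaussianMoments (k : ℕ) (ν : ℝ) (A : Measure ℝ) : Prop :=
  ∀ t : ℕ, 1 ≤ t → t ≤ k → |(∫ x, x ^ t ∂A) - ∫ x, x ^ t ∂(gaussianReal 0 1)| ≤ ν

/-- For a unit vector `v`, the law of `a v + (g - ⟨v, g⟩ v)` with `a ∼ A` and a standard Gaussian
vector `g` independent of `a`: it is `A` in the direction of `v` and standard Gaussian in the
orthogonal complement of `v`. -/
def hiddenDirection {m : ℕ} (A : Measure ℝ) (v : EuclideanSpace ℝ (Fin m)) :
    Measure (EuclideanSpace ℝ (Fin m)) :=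
  (A.prod (stdGaussian (EuclideanSpace ℝ (Fin m)))).map
    (fun z => z.1 • v + (z.2 - inner ℝ v z.2 • v))

/-- Labelled examples `(x, y)` with `x ∈ ℝᵐ` and `y ∈ {-1, 1} = ℤˣ`. -/
abbrev Example (m : ℕ) : Type := EuclideanSpace ℝ (Fin m) × ℤˣ

/-- The distribution `D_v^{A,B,p}`: with probability `p` the pair `(x, 1)` where `x` is distributed
as `A` along `v`, with probability `1 - p` the pair `(x, -1)` where `x` is distributed as `B`
along `v`. -/
def hiddenDirectionLabelled {m : ℕ} (A B : Measure ℝ) (p : ℝ) (v : EuclideanSpace ℝ (Fin m)) :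
    Measure (Example m) :=
  ENNReal.ofReal p • (hiddenDirection A v).map (fun x => (x, (1 : ℤˣ))) +
    ENNReal.ofReal (1 - p) • (hiddenDirection B v).map (fun x => (x, (-1 : ℤˣ)))

/-- (Measurable) hypotheses `h : ℝᵐ → {-1, 1}`. -/
abbrev Hypothesis (m : ℕ) : Type := {h : EuclideanSpace ℝ (Fin m) → ℤˣ // Measurable h}

/-- The misclassification error `P_{(x,y) ∼ D}[h(x) ≠ y]`. -/
def misclassError {m : ℕ} (D : Measure (Example m)) (h : Hypothesis m) : ℝ :=
  D.real {z | h.1 z.1 ≠ z.2}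

/-- A statistical query: a measurable function with values in `[-1, 1]`, and the accuracy
(tolerance) to which its expectation is requested. -/
structure StatQuery (X : Type) [MeasurableSpace X] where
  toFun : X → ℝ
  measurable_toFun : Measurable toFun
  abs_le_one : ∀ x, |toFun x| ≤ 1
  accuracy : ℝ
  accuracy_pos : 0 < accuracy

/-- A valid statistical query oracle for `D`: it answers every query by a value that is within the
requested accuracy of the expectation of the query under `D`. -/
def IsSQOracle {X : Type} [MeasurableSpace X] (D : Measure X) (O : StatQuery X → ℝ) : Prop :=
  ∀ f : StatQuery X, |O f - ∫ x, f.toFun x ∂D| ≤ f.accuracy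

/-- A deterministic adaptive statistical query algorithm with outputs in `H`: it either stops with
an output, or asks a query and continues depending on the answer. -/
inductive SQAlgorithm (X : Type) [MeasurableSpace X] (H : Type) : Type
  | output (h : H) : SQAlgorithm X H
  | query (f : StatQuery X) (next : ℝ → SQAlgorithm X H) : SQAlgorithm X H

/-- The output of the algorithm when its queries are answered by `O`. -/
def SQAlgorithm.run {X : Type} [MeasurableSpace X] {H : Type} (O : StatQuery X → ℝ) :
    SQAlgorithm X H → H
  | .output h => h
  | .query f next => SQAlgorithm.run O (next (O f))

/-- The queries that the algorithm makes, in order, when they are answered by `O`. -/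
def SQAlgorithm.queries {X : Type} [MeasurableSpace X] {H : Type} (O : StatQuery X → ℝ) :
    SQAlgorithm X H → List (StatQuery X)
  | .output _ => []
  | .query f next => f :: SQAlgorithm.queries O (next (O f))

/-- A randomized SQ algorithm, given as a family `alg` of deterministic ones indexed by a random
seed `ω ∼ P`, achieves misclassification error below `ε` on all the distributions `D_v^{A,B,p}`:
for every unit vector `v` and every valid oracle for `D_v^{A,B,p}`, it does so with probability at
least `2/3` over its seed. A deterministic algorithm is the case of a one-point seed space. -/
def AchievesErrorBelow {m : ℕ} {Ω : Type*} [MeasurableSpace Ω] (P : Measure Ω)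
    (alg : Ω → SQAlgorithm (Example m) (Hypothesis m)) (A B : Measure ℝ) (p ε : ℝ) : Prop :=
  ∀ v : EuclideanSpace ℝ (Fin m), ‖v‖ = 1 →
    ∀ O : StatQuery (Example m) → ℝ, IsSQOracle (hiddenDirectionLabelled A B p v) O →
      ∃ S : Set Ω, MeasurableSet S ∧ 2 / 3 ≤ P S ∧
        ∀ ω ∈ S, misclassError (hiddenDirectionLabelled A B p v) ((alg ω).run O) < ε

/-- `L` is the list of queries made in some run of `alg`, on some distribution `D_v^{A,B,p}`
accessed through a valid oracle. -/
def IsQueryTranscript {m : ℕ} {Ω : Type*}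
    (alg : Ω → SQAlgorithm (Example m) (Hypothesis m)) (A B : Measure ℝ) (p : ℝ)
    (L : List (StatQuery (Example m))) : Prop :=
  ∃ (ω : Ω) (v : EuclideanSpace ℝ (Fin m)) (O : StatQuery (Example m) → ℝ),
    ‖v‖ = 1 ∧ IsSQOracle (hiddenDirectionLabelled A B p v) O ∧ L = (alg ω).queries O

/-- `N = 2 ^ (C c² m) · (ρ / α)`, which is `∞` when `α = 0 < ρ`. -/
def queryBound (C c : ℝ) (m : ℕ) (ρ : ℝ) (α : ℝ≥0∞) : ℝ≥0∞ :=
  ENNReal.ofReal ((2 : ℝ) ^ (C * c ^ 2 * (m : ℝ)) * ρ) / α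

end

/-! ### Stein's identity, Hermite polynomials, and their values under nearly matching moments -/

section GaussianPolynomials

open Polynomial

/-! Compare every D_v with the null distribution, in which x is standard Gaussian and independent of
the label. Under it no hypothesis errs with probability below min(p, 1-p)
(`min_le_nullMean_misclassQuery`). An adversarial oracle gives the null answer whenever that is
valid for D_v. After averaging over the seed, one deterministic algorithm succeeds on two thirds of
a finite family of directions. If each query separates at most K of them from the null, few queries
leave many directions on which the output is the hypothesis h computed from null answers. On these
the error of h is far below its null error, so the single query "h errs" separates them all, a
contradiction (`not_achievesErrorBelow_of_card_distinguished_le`).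

To bound K, let φ be the centered density dA/dN(0,1) - 1 (likewise for B). The deviation of a
bounded function from its Gaussian mean is its inner product in L²(N(0,I)) with φ(⟨v,x⟩). If it is
large, with one sign, for many v, then the sum of these functions has large norm, so their pairwise
correlations are large on average (`card_distinguished_le`). In the Hermite basis the correlation is
Σ b_n² ⟨u,v⟩^n (`hasSum_inner_liftDirection`). When |⟨u,v⟩| ≤ c/8 and c ≤ 1, the moments control the
terms n ≤ k through |b_n| ≤ ν 2^n, and the rest is at most χ² c^k. The total is at most ν² + α c^k ≤
ρ. For the other pairs Cauchy–Schwarz gives α, and by Hoeffding such pairs are exponentially rare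
among the vectors ε/√m with signs ε.

If α ≤ 4ρ, a single direction already suffices, since no query separates it from the null; otherwise
the hypotheses force c ≤ 1 and the sign vectors are used. -/

lemma memLp_pow_gaussianReal (n : ℕ) :
    MemLp (fun x : ℝ => x ^ n) 2 (gaussianReal 0 1) := by
  have h : MemLp (fun x : ℝ => x) ((n * 2 : ℕ) : ℝ≥0∞) (gaussianReal 0 1) :=
    memLp_id_gaussianReal' _ (ENNReal.natCast_ne_top _)
  rcases Nat.eq_zero_or_pos n with rfl | hn
  · simpa using memLp_const (1 : ℝ)
  refine (memLp_two_iff_integrable_sq (by fun_prop)).2 ?_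
  have h2 := h.integrable_norm_pow (by omega)
  refine h2.congr (Filter.Eventually.of_forall fun x => ?_)
  simp only [Real.norm_eq_abs, pow_mul, ← abs_pow]
  exact abs_of_nonneg (sq_nonneg _)

lemma memLp_eval_gaussianReal (P : ℝ[X]) :
    MemLp (fun x : ℝ => P.eval x) 2 (gaussianReal 0 1) := by
  simp_rw [eval_eq_sum_range]
  exact memLp_finsetSum _ fun i _ => (memLp_pow_gaussianReal i).const_mul _

lemma integrable_eval_gaussianReal (P : ℝ[X]) :
    Integrable (fun x : ℝ => P.eval x) (gaussianReal 0 1) :=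
  (memLp_eval_gaussianReal P).integrable (by norm_num)

lemma integral_gaussianReal_eq (f : ℝ → ℝ) :
    ∫ x, f x ∂(gaussianReal 0 1) = ∫ x, f x * gaussianPDFReal 0 1 x := by
  rw [integral_gaussianReal_eq_integral_smul one_ne_zero]
  simp [mul_comm]

lemma integrable_mul_gaussianPDFReal {f : ℝ → ℝ} (hf : Integrable f (gaussianReal 0 1)) :
    Integrable (fun x => f x * gaussianPDFReal 0 1 x) := by
  rw [gaussianReal_of_var_ne_zero _ one_ne_zero,
    integrable_withDensity_iff (measurable_gaussianPDF _ _)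
      (Filter.Eventually.of_forall fun x => gaussianPDF_lt_top)] at hf
  simpa [toReal_gaussianPDF] using hf

lemma hasDerivAt_gaussianPDFReal (x : ℝ) :
    HasDerivAt (gaussianPDFReal 0 1) (-x * gaussianPDFReal 0 1 x) x := by
  have h : HasDerivAt (fun y : ℝ => -(y - 0) ^ 2 / (2 * ((1 : NNReal) : ℝ))) (-x) x := by
    have h1 : HasDerivAt (fun y : ℝ => -y ^ 2 / 2) (-(2 * x) / 2) x := by
      simpa using ((hasDerivAt_pow 2 x).fun_neg).div_const 2
    simpa [neg_div] using h1
  have h2 := (h.exp).const_mul ((√(2 * Real.pi * ((1 : NNReal) : ℝ)))⁻¹)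
  rw [gaussianPDFReal_def]
  refine h2.congr_deriv ?_
  ring

/-- Stein's identity for polynomials. -/
lemma integral_mul_eval_gaussianReal (P : ℝ[X]) :
    ∫ x, x * P.eval x ∂(gaussianReal 0 1) = ∫ x, P.derivative.eval x ∂(gaussianReal 0 1) := by
  rw [integral_gaussianReal_eq, integral_gaussianReal_eq]
  have hX : Integrable (fun x : ℝ => x * P.eval x) (gaussianReal 0 1) := by
    refine (integrable_eval_gaussianReal (X * P)).congr (Filter.Eventually.of_forall fun x => ?_)
    simp only [eval_mul, eval_X]
  have h := integral_mul_deriv_eq_deriv_mul_of_integrable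
    (u := fun x => P.eval x) (v := gaussianPDFReal 0 1)
    (u' := fun x => P.derivative.eval x) (v' := fun x => -x * gaussianPDFReal 0 1 x)
    (fun x _ => P.hasDerivAt x) (fun x _ => hasDerivAt_gaussianPDFReal x)
    ?_ ?_ ?_
  · rw [← neg_inj, ← h, ← integral_neg]
    congr 1; ext x; ring
  · refine (integrable_mul_gaussianPDFReal hX).neg.congr (Filter.Eventually.of_forall fun x => ?_)
    simp only [Pi.neg_apply, Pi.mul_apply]; ring
  · exact integrable_mul_gaussianPDFReal (integrable_eval_gaussianReal _)
  · exact integrable_mul_gaussianPDFReal (integrable_eval_gaussianReal _)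

/-- The probabilists' Hermite polynomials with real coefficients. -/
noncomputable def realHermite (n : ℕ) : ℝ[X] := (hermite n).map (Int.castRingHom ℝ)

lemma realHermite_zero : realHermite 0 = 1 := by simp [realHermite]

lemma realHermite_succ (n : ℕ) :
    realHermite (n + 1) = X * realHermite n - derivative (realHermite n) := by
  simp [realHermite, hermite_succ, derivative_map]

lemma derivative_realHermite_succ (n : ℕ) :
    derivative (realHermite (n + 1)) = ((n : ℝ[X]) + 1) * realHermite n := by
  induction n with
  | zero => simp [realHermite_succ, realHermite_zero]
  | succ n ih =>
    rw [realHermite_succ (n + 1), derivative_sub, derivative_mul, ih, derivative_X,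
      derivative_mul]
    have : derivative ((n : ℝ[X]) + 1) = 0 := by
      simp
    rw [this, realHermite_succ n]
    push_cast
    ring

/-- Two-step induction on H_{t+2} = X H_{t+1} - (t+1) H_t. The factor X^j is what lets the
multiplication by X be passed to the moments. It is applied to the difference between the
expectations under A and under N(0,1); dividing by √t! then leaves ν 2^t for the normalized Hermite
coefficient. -/
lemma abs_apply_realHermite_le {Λ : ℝ[X] →ₗ[ℝ] ℝ} {k : ℕ} {ν : ℝ}
    (h : ∀ j ≤ k, |Λ (X ^ j)| ≤ ν) (t j : ℕ) (htj : j + t ≤ k) :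
    |Λ (X ^ j * realHermite t)| ≤ ν * (2 ^ t * √(t.factorial : ℝ)) := by
  have hν : 0 ≤ ν := (abs_nonneg _).trans (h 0 (Nat.zero_le k))
  induction t using Nat.twoStepInduction generalizing j with
  | zero => simpa [realHermite_zero] using h j (by omega)
  | one =>
    have := h (j + 1) (by omega)
    have h1 : realHermite 1 = X := by simp [realHermite_succ, realHermite_zero]
    rw [h1, ← pow_succ]
    simp only [pow_one, Nat.factorial_one, Nat.cast_one, Real.sqrt_one, mul_one]
    linarith
  | more t ih0 ih1 =>
    have e : X ^ j * realHermite (t + 2) =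
        X ^ (j + 1) * realHermite (t + 1) - ((t : ℝ) + 1) • (X ^ j * realHermite t) := by
      rw [realHermite_succ (t + 1), derivative_realHermite_succ, smul_eq_C_mul]
      simp only [map_add, map_natCast, map_one]
      ring
    have h0 := ih0 j (by omega)
    have h1 := ih1 (j + 1) (by omega)
    rw [e, map_sub, map_smul, smul_eq_mul]
    refine (abs_sub _ _).trans ?_
    rw [abs_mul, abs_of_nonneg (by positivity : (0 : ℝ) ≤ t + 1)]
    have hf1 : √((t + 1).factorial : ℝ) = √(t + 1) * √(t.factorial : ℝ) := by
      rw [Nat.factorial_succ, Nat.cast_mul, Real.sqrt_mul (by positivity)]; push_cast; rfl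
    have hf2 : √((t + 2).factorial : ℝ) = √(t + 2) * (√(t + 1) * √(t.factorial : ℝ)) := by
      rw [Nat.factorial_succ, Nat.cast_mul, Real.sqrt_mul (by positivity), hf1]
      push_cast; congr 2; ring
    rw [hf1] at h1
    rw [hf2]
    have hs : √((t : ℝ) + 1) * √((t : ℝ) + 1) = t + 1 := Real.mul_self_sqrt (by positivity)
    have hle : √((t : ℝ) + 1) ≤ √((t : ℝ) + 2) := Real.sqrt_le_sqrt (by linarith)
    have hone : 1 ≤ √((t : ℝ) + 2) :=
      Real.one_le_sqrt.2 (by linarith [(Nat.cast_nonneg t : (0 : ℝ) ≤ t)])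
    set a := √((t : ℝ) + 1)
    set b := √((t : ℝ) + 2)
    set F := √(t.factorial : ℝ)
    have ha : 0 ≤ a := Real.sqrt_nonneg _
    have hF : 0 ≤ F := Real.sqrt_nonneg _
    have hG : 0 ≤ ν * 2 ^ t * a * F := by positivity
    -- Writing t+1 as a² makes a common factor appear; then 2 + a ≤ 4b because 1 ≤ b and a ≤ b.
    calc _ ≤ ν * (2 ^ (t + 1) * (a * F)) + ((t : ℝ) + 1) * (ν * (2 ^ t * F)) := by
            gcongr
      _ = (ν * 2 ^ t * a * F) * (2 + a) := by rw [← hs]; ring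
      _ ≤ (ν * 2 ^ t * a * F) * (4 * b) := by gcongr; linarith
      _ = _ := by ring

end GaussianPolynomials

/-! ### Hidden direction laws as densities against the standard Gaussian -/

section HiddenDirection

variable {m : ℕ}

lemma inner_hiddenDirection_map {v : EuclideanSpace ℝ (Fin m)} (hv : ‖v‖ = 1) (a : ℝ)
    (g : EuclideanSpace ℝ (Fin m)) :
    inner ℝ v (a • v + (g - inner ℝ v g • v)) = a := by
  rw [inner_add_right, inner_sub_right, real_inner_smul_right, real_inner_smul_right,
    real_inner_self_eq_norm_sq, hv]
  ring

lemma measurable_hiddenDirection_map (v : EuclideanSpace ℝ (Fin m)) :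
    Measurable (fun z : ℝ × EuclideanSpace ℝ (Fin m) => z.1 • v + (z.2 - inner ℝ v z.2 • v)) := by
  fun_prop

/-- The two summands are independent, and by Pythagoras their characteristic functions multiply to
the Gaussian one. Seeing the Gaussian as its own hidden direction law yields its marginal along v,
the densities of the other laws, and the disintegration of integrals along v. -/
lemma hiddenDirection_gaussianReal {v : EuclideanSpace ℝ (Fin m)} (hv : ‖v‖ = 1) :
    hiddenDirection (gaussianReal 0 1) v = stdGaussian (EuclideanSpace ℝ (Fin m)) := by
  have hmeas := measurable_hiddenDirection_map v
  have : IsProbabilityMeasure (hiddenDirection (gaussianReal 0 1) v) :=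
    Measure.isProbabilityMeasure_map hmeas.aemeasurable
  refine Measure.ext_of_charFun (funext fun t => ?_)
  rw [charFun_stdGaussian, charFun_apply, hiddenDirection,
    integral_map hmeas.aemeasurable (by fun_prop)]
  have e : ∀ z : ℝ × EuclideanSpace ℝ (Fin m),
      Complex.exp ((inner ℝ (z.1 • v + (z.2 - inner ℝ v z.2 • v)) t : ℝ) * Complex.I) =
      Complex.exp (((inner ℝ v t : ℝ) : ℂ) * (z.1 : ℂ) * Complex.I) *
        Complex.exp ((inner ℝ z.2 (t - inner ℝ v t • v) : ℝ) * Complex.I) := by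
    intro z
    rw [← Complex.exp_add, ← add_mul]
    congr 2
    rw [inner_add_left, inner_sub_left, inner_sub_right, real_inner_smul_left,
      real_inner_smul_left, real_inner_smul_right, real_inner_comm v z.2]
    push_cast
    ring
  simp_rw [e]
  rw [integral_prod_mul (fun a : ℝ => Complex.exp (((inner ℝ v t : ℝ) : ℂ) * (a : ℂ) * Complex.I))
    (fun g : EuclideanSpace ℝ (Fin m) =>
      Complex.exp ((inner ℝ g (t - inner ℝ v t • v) : ℝ) * Complex.I)),
    ← charFun_apply_real, ← charFun_apply, charFun_stdGaussian, charFun_gaussianReal,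
    ← Complex.exp_add]
  congr 1
  have : ‖t - inner ℝ v t • v‖ ^ 2 = ‖t‖ ^ 2 - (inner ℝ v t) ^ 2 := by
    rw [norm_sub_sq_real, norm_smul, real_inner_smul_right, hv, real_inner_comm, Real.norm_eq_abs,
      mul_one, sq_abs]
    ring
  have hc := congrArg (fun r : ℝ => (r : ℂ)) this
  push_cast at hc
  rw [hc]
  push_cast
  ring

lemma measurePreserving_inner {v : EuclideanSpace ℝ (Fin m)} (hv : ‖v‖ = 1) :
    MeasurePreserving (fun x => inner ℝ v x) (stdGaussian (EuclideanSpace ℝ (Fin m)))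
      (gaussianReal 0 1) := by
  refine ⟨by fun_prop, ?_⟩
  rw [← hiddenDirection_gaussianReal hv, hiddenDirection,
    Measure.map_map (by fun_prop) (measurable_hiddenDirection_map v)]
  have : (fun x => inner ℝ v x) ∘ (fun z : ℝ × EuclideanSpace ℝ (Fin m) =>
      z.1 • v + (z.2 - inner ℝ v z.2 • v)) = Prod.fst := by
    ext z
    exact inner_hiddenDirection_map hv _ _
  rw [this]
  simp

lemma hiddenDirection_eq_withDensity {A : Measure ℝ} [IsProbabilityMeasure A]
    (hA : A ≪ gaussianReal 0 1) {v : EuclideanSpace ℝ (Fin m)} (hv : ‖v‖ = 1) :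
    hiddenDirection A v = (stdGaussian (EuclideanSpace ℝ (Fin m))).withDensity
      (fun x => A.rnDeriv (gaussianReal 0 1) (inner ℝ v x)) := by
  have hmeas := measurable_hiddenDirection_map v
  have hφ := Measure.measurable_rnDeriv A (gaussianReal 0 1)
  have hφv : Measurable fun x : EuclideanSpace ℝ (Fin m) =>
      A.rnDeriv (gaussianReal 0 1) (inner ℝ v x) := hφ.comp (by fun_prop)
  ext s hs
  rw [withDensity_apply _ hs, ← hiddenDirection_gaussianReal hv, hiddenDirection, hiddenDirection,
    setLIntegral_map hs hφv hmeas, Measure.map_apply hmeas hs]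
  simp_rw [inner_hiddenDirection_map hv]
  conv_lhs => rw [← Measure.withDensity_rnDeriv_eq A (gaussianReal 0 1) hA]
  rw [prod_withDensity_left hφ, withDensity_apply _ (hmeas hs)]

end HiddenDirection

/-! ### Correlations of Hermite polynomials in two directions -/

section HermiteCorrelation

open Polynomial

variable {m : ℕ}

lemma memLp_eval_inner (P : ℝ[X]) {v : EuclideanSpace ℝ (Fin m)} (hv : ‖v‖ = 1) :
    MemLp (fun x => P.eval (inner ℝ v x)) 2 (stdGaussian (EuclideanSpace ℝ (Fin m))) :=
  (memLp_eval_gaussianReal P).comp_measurePreserving (measurePreserving_inner hv)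

lemma integrable_eval_inner_mul (P Q : ℝ[X]) {u v : EuclideanSpace ℝ (Fin m)} (hu : ‖u‖ = 1)
    (hv : ‖v‖ = 1) :
    Integrable (fun x => P.eval (inner ℝ u x) * Q.eval (inner ℝ v x))
      (stdGaussian (EuclideanSpace ℝ (Fin m))) :=
  (memLp_eval_inner P hu).integrable_mul (memLp_eval_inner Q hv)

lemma integral_stdGaussian_eq {u : EuclideanSpace ℝ (Fin m)} (hu : ‖u‖ = 1)
    {f : EuclideanSpace ℝ (Fin m) → ℝ}
    (hf : Integrable f (stdGaussian (EuclideanSpace ℝ (Fin m)))) :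
    ∫ x, f x ∂(stdGaussian (EuclideanSpace ℝ (Fin m))) =
      ∫ g, ∫ a, f (a • u + (g - inner ℝ u g • u)) ∂(gaussianReal 0 1)
        ∂(stdGaussian (EuclideanSpace ℝ (Fin m))) := by
  have hmeas := measurable_hiddenDirection_map u
  have hf' : Integrable f (hiddenDirection (gaussianReal 0 1) u) := by
    rwa [hiddenDirection_gaussianReal hu]
  conv_lhs => rw [← hiddenDirection_gaussianReal hu, hiddenDirection]
  rw [hiddenDirection] at hf'
  rw [integral_map hmeas.aemeasurable hf'.aestronglyMeasurable, integral_prod_symm]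
  exact (integrable_map_measure hf'.aestronglyMeasurable hmeas.aemeasurable).1 hf'

/-- Gaussian integration by parts along u: on each line parallel to u, ⟨v,·⟩ is affine with slope
⟨u,v⟩, so the one-dimensional Stein identity applies and differentiating the second factor costs
⟨u,v⟩. -/
lemma integral_inner_mul_eval_mul_eval (P Q : ℝ[X]) {u v : EuclideanSpace ℝ (Fin m)}
    (hu : ‖u‖ = 1) (hv : ‖v‖ = 1) :
    ∫ x, (X * P).eval (inner ℝ u x) * Q.eval (inner ℝ v x)
        ∂(stdGaussian (EuclideanSpace ℝ (Fin m))) =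
      ∫ x, (derivative P).eval (inner ℝ u x) * Q.eval (inner ℝ v x)
        ∂(stdGaussian (EuclideanSpace ℝ (Fin m))) +
      inner ℝ u v * ∫ x, P.eval (inner ℝ u x) * (derivative Q).eval (inner ℝ v x)
        ∂(stdGaussian (EuclideanSpace ℝ (Fin m))) := by
  rw [← integral_const_mul, ← integral_add (integrable_eval_inner_mul _ _ hu hv)
    ((integrable_eval_inner_mul _ _ hu hv).const_mul _),
    integral_stdGaussian_eq hu (integrable_eval_inner_mul _ _ hu hv),
    integral_stdGaussian_eq hu ((integrable_eval_inner_mul _ _ hu hv).fun_add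
      ((integrable_eval_inner_mul _ _ hu hv).const_mul _))]
  congr 1
  ext g
  set w := inner ℝ v (g - inner ℝ u g • u) with hw
  have hlin : ∀ a : ℝ, inner ℝ v (a • u + (g - inner ℝ u g • u)) = inner ℝ u v * a + w := by
    intro a
    rw [inner_add_right, real_inner_smul_right, real_inner_comm]
    ring
  have h := integral_mul_eval_gaussianReal (P * Q.comp (C (inner ℝ u v) * X + C w))
  simp_rw [inner_hiddenDirection_map hu, hlin]
  simp only [eval_mul, eval_comp, eval_add, eval_C, eval_X, derivative_mul, derivative_comp,
    derivative_add, derivative_C, derivative_X, mul_one, zero_mul, zero_add, add_zero] at h ⊢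
  calc _ = _ := by simp only [mul_assoc]
    _ = _ := h
    _ = _ := by congr 1; ext a; ring

lemma integral_realHermite_succ_inner (n : ℕ) {v : EuclideanSpace ℝ (Fin m)} (hv : ‖v‖ = 1) :
    ∫ x, (realHermite (n + 1)).eval (inner ℝ v x)
      ∂(stdGaussian (EuclideanSpace ℝ (Fin m))) = 0 := by
  have h := integral_inner_mul_eval_mul_eval (realHermite n) 1 hv hv
  simp only [derivative_one, eval_one, eval_zero, mul_one, mul_zero, integral_zero, add_zero] at h
  have i1 := integrable_eval_inner_mul (X * realHermite n) 1 hv hv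
  have i2 := integrable_eval_inner_mul (derivative (realHermite n)) 1 hv hv
  simp only [eval_one, mul_one] at i1 i2
  simp_rw [realHermite_succ, eval_sub]
  rw [integral_sub i1 i2, h, sub_self]

/-- Since H_{k+1} = X H_k - H_k', integration by parts turns the pair (k+1, n+1) into ⟨u,v⟩ times
the pair of H_k with H_{n+1}' = (n+1) H_n. Induction ends at index 0, where a Hermite polynomial of
positive degree has mean zero. -/
lemma integral_realHermite_inner_mul (k n : ℕ) {u v : EuclideanSpace ℝ (Fin m)}
    (hu : ‖u‖ = 1) (hv : ‖v‖ = 1) :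
    ∫ x, (realHermite k).eval (inner ℝ u x) * (realHermite n).eval (inner ℝ v x)
        ∂(stdGaussian (EuclideanSpace ℝ (Fin m))) =
      if k = n then (n.factorial : ℝ) * inner ℝ u v ^ n else 0 := by
  induction k generalizing n with
  | zero =>
    cases n with
    | zero => simp [realHermite_zero]
    | succ n => simpa [realHermite_zero] using integral_realHermite_succ_inner n hv
  | succ k ih =>
    cases n with
    | zero => simpa [realHermite_zero] using integral_realHermite_succ_inner k hu
    | succ n =>
      have h := integral_inner_mul_eval_mul_eval (realHermite k) (realHermite (n + 1)) hu hv
      have e : ∀ x, (realHermite (k + 1)).eval (inner ℝ u x) *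
          (realHermite (n + 1)).eval (inner ℝ v x) =
          (X * realHermite k).eval (inner ℝ u x) * (realHermite (n + 1)).eval (inner ℝ v x) -
          (derivative (realHermite k)).eval (inner ℝ u x) *
            (realHermite (n + 1)).eval (inner ℝ v x) := by
        intro x
        rw [realHermite_succ k, eval_sub, sub_mul]
      have e2 : ∀ x, (realHermite k).eval (inner ℝ u x) *
          (((n : ℝ[X]) + 1) * realHermite n).eval (inner ℝ v x) =
          ((n : ℝ) + 1) * ((realHermite k).eval (inner ℝ u x) *
          (realHermite n).eval (inner ℝ v x)) := by
        intro x
        simp only [eval_mul, eval_add, eval_natCast, eval_one]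
        ring
      simp_rw [e]
      rw [integral_sub (integrable_eval_inner_mul _ _ hu hv)
        (integrable_eval_inner_mul _ _ hu hv), h, add_sub_cancel_left,
        derivative_realHermite_succ]
      simp_rw [e2]
      rw [integral_const_mul, ih]
      by_cases hkn : k = n
      · simp [hkn, Nat.factorial_succ, pow_succ]
        ring
      · simp [hkn]

end HermiteCorrelation

/-! ### Completeness of the Hermite polynomials and expansion of correlations -/

section HermiteBasis

open Polynomial

lemma inner_toLp_two {X : Type*} [MeasurableSpace X] {μ : Measure X} {f g : X → ℝ}
    (hf : MemLp f 2 μ) (hg : MemLp g 2 μ) :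
    inner ℝ (hf.toLp f) (hg.toLp g) = ∫ x, f x * g x ∂μ := by
  rw [L2.inner_def]
  refine integral_congr_ae ?_
  filter_upwards [hf.coeFn_toLp, hg.coeFn_toLp] with x h1 h2
  rw [h1, h2]
  simp [mul_comm]

lemma memLp_exp_mul_gaussianReal (t : ℝ) :
    MemLp (fun x : ℝ => Real.exp (t * x)) 2 (gaussianReal 0 1) := by
  refine (memLp_two_iff_integrable_sq (by fun_prop)).2 ?_
  refine (integrable_exp_mul_gaussianReal (2 * t)).congr (Filter.Eventually.of_forall fun x => ?_)
  simp only [← Real.exp_nat_mul]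
  congr 1; push_cast; ring

lemma memLp_exp_abs_gaussianReal (t : ℝ) :
    MemLp (fun x : ℝ => Real.exp |t * x|) 2 (gaussianReal 0 1) := by
  refine ((memLp_exp_mul_gaussianReal t).add (memLp_exp_mul_gaussianReal (-t))).mono
    (by fun_prop) (Filter.Eventually.of_forall fun x => ?_)
  simp only [Pi.add_apply, Real.norm_eq_abs, Real.abs_exp]
  refine le_trans ?_ (le_abs_self _)
  rw [neg_mul]
  rcases abs_cases (t * x) with ⟨h, _⟩ | ⟨h, _⟩ <;> rw [h]
  · linarith [Real.exp_pos (-(t * x))]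
  · linarith [Real.exp_pos (t * x)]

/-- A square integrable function orthogonal to all monomials vanishes. -/
lemma ae_eq_zero_of_integral_pow_mul_eq_zero {f : ℝ → ℝ} (hf : MemLp f 2 (gaussianReal 0 1))
    (h : ∀ n : ℕ, ∫ x, x ^ n * f x ∂(gaussianReal 0 1) = 0) : f =ᵐ[gaussianReal 0 1] 0 := by
  have hfi : Integrable f (gaussianReal 0 1) := hf.integrable (by norm_num)
  -- The Fourier transform of f against the Gaussian vanishes: expand the exponential in powers and
  -- integrate termwise, with dominating function exp|tx| |f|, integrable as a product of two L²
  -- functions.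
  have hchar : ∀ t : ℝ,
      ∫ x, Complex.exp (t * x * Complex.I) * (f x : ℂ) ∂(gaussianReal 0 1) = 0 := by
    intro t
    have hs : ∀ x : ℝ, HasSum (fun n : ℕ => |t * x| ^ n / n.factorial * |f x|)
        (Real.exp |t * x| * |f x|) := by
      intro x
      have := NormedSpace.expSeries_div_hasSum_exp (|t * x|)
      rw [← Real.exp_eq_exp_ℝ] at this
      exact this.mul_right _
    have hsum := hasSum_integral_of_dominated_convergence (μ := gaussianReal 0 1)
      (F := fun (n : ℕ) (x : ℝ) =>
        ((t * x * Complex.I) ^ n / (n.factorial : ℂ)) * (f x : ℂ))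
      (f := fun x : ℝ => Complex.exp (t * x * Complex.I) * (f x : ℂ))
      (fun n x => |t * x| ^ n / n.factorial * |f x|) ?_ ?_ ?_ ?_ ?_
    · have hz : ∀ n : ℕ, ∫ x : ℝ, ((t * x * Complex.I) ^ n / (n.factorial : ℂ)) * (f x : ℂ)
          ∂(gaussianReal 0 1) = 0 := by
        intro n
        have e : ∀ x : ℝ, ((t * x * Complex.I) ^ n / (n.factorial : ℂ)) * (f x : ℂ) =
            ((t * Complex.I) ^ n / (n.factorial : ℂ)) * ((x ^ n * f x : ℝ) : ℂ) := by
          intro x; push_cast; ring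
        simp_rw [e]
        rw [integral_const_mul, integral_complex_ofReal, h n]
        simp
      simp_rw [hz] at hsum
      exact hsum.unique hasSum_zero
    · intro n
      exact (Measurable.aestronglyMeasurable (by fun_prop)).mul
        (Complex.continuous_ofReal.comp_aestronglyMeasurable hf.1)
    · intro n
      refine Filter.Eventually.of_forall fun x => le_of_eq ?_
      simp [abs_mul]
    · exact Filter.Eventually.of_forall fun x => (hs x).summable
    · simp_rw [fun x => (hs x).tsum_eq]
      exact (memLp_exp_abs_gaussianReal t).integrable_mul hf.abs
    · refine Filter.Eventually.of_forall fun x => ?_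
      have := NormedSpace.expSeries_div_hasSum_exp (t * x * Complex.I : ℂ)
      rw [← Complex.exp_eq_exp_ℂ] at this
      exact this.mul_right _
  have hp : AEMeasurable (fun x => ENNReal.ofReal (f x)) (gaussianReal 0 1) :=
    hf.1.aemeasurable.ennreal_ofReal
  have hn : AEMeasurable (fun x => ENNReal.ofReal (-f x)) (gaussianReal 0 1) :=
    hf.1.aemeasurable.neg.ennreal_ofReal
  have : IsFiniteMeasure ((gaussianReal 0 1).withDensity fun x => ENNReal.ofReal (f x)) :=
    isFiniteMeasure_withDensity_ofReal hfi.2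
  have : IsFiniteMeasure ((gaussianReal 0 1).withDensity fun x => ENNReal.ofReal (-f x)) :=
    isFiniteMeasure_withDensity_ofReal hfi.neg.2
  have hexp : ∀ (t : ℝ) {g : ℝ → ℝ}, Integrable g (gaussianReal 0 1) →
      Integrable (fun x => (g x : ℝ) • Complex.exp (t * x * Complex.I)) (gaussianReal 0 1) := by
    intro t g hg
    refine hg.norm.mono' (hg.1.smul (Measurable.aestronglyMeasurable (by fun_prop)))
      (Filter.Eventually.of_forall fun x => ?_)
    have e : (t * x * Complex.I : ℂ) = ((t * x : ℝ) : ℂ) * Complex.I := by push_cast; ring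
    rw [norm_smul, e, Complex.norm_exp_ofReal_mul_I, mul_one]
  -- The positive and negative parts of f are densities of finite measures with the same
  -- characteristic function, so the parts agree almost everywhere; having disjoint supports, both
  -- vanish.
  have heq : (gaussianReal 0 1).withDensity (fun x => ENNReal.ofReal (f x)) =
      (gaussianReal 0 1).withDensity (fun x => ENNReal.ofReal (-f x)) := by
    refine Measure.ext_of_charFun (funext fun t => ?_)
    rw [charFun_apply_real, charFun_apply_real,
      integral_withDensity_eq_integral_toReal_smul₀ hp (by simp),
      integral_withDensity_eq_integral_toReal_smul₀ hn (by simp), ← sub_eq_zero,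
      ← integral_sub (hexp t ?_) (hexp t ?_), ← hchar t]
    · congr 1
      ext x
      rw [← sub_smul, Complex.real_smul, mul_comm]
      congr 2
      simp only [ENNReal.toReal_ofReal']
      exact max_zero_sub_max_neg_zero_eq_self (f x)
    · simpa only [ENNReal.toReal_ofReal'] using hfi.pos_part
    · simpa only [Pi.neg_apply, ENNReal.toReal_ofReal'] using hfi.neg.pos_part
  have hae := (withDensity_eq_iff_of_sigmaFinite hp hn).1 heq
  filter_upwards [hae] with x hx
  simp only [Pi.zero_apply]
  rcases lt_trichotomy 0 (f x) with h0 | h0 | h0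
  · rw [ENNReal.ofReal_of_nonpos (by linarith : -f x ≤ 0), ENNReal.ofReal_eq_zero] at hx
    linarith
  · exact h0.symm
  · rw [ENNReal.ofReal_of_nonpos h0.le, eq_comm, ENNReal.ofReal_eq_zero] at hx
    linarith

/-- The case u = v of the two-direction identity, in dimension one. -/
lemma integral_realHermite_mul (k n : ℕ) :
    ∫ x, (realHermite k).eval x * (realHermite n).eval x ∂(gaussianReal 0 1) =
      if k = n then (n.factorial : ℝ) else 0 := by
  have hu : ‖(EuclideanSpace.single (0 : Fin 1) (1 : ℝ))‖ = 1 := by simp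
  have h := integral_realHermite_inner_mul k n hu hu
  rw [real_inner_self_eq_norm_sq, hu] at h
  simp only [one_pow, mul_one] at h
  rw [← h, ← (measurePreserving_inner hu).map_eq, integral_map (by fun_prop)]
  exact ((realHermite k).continuous.mul (realHermite n).continuous).aestronglyMeasurable

/-- The normalized Hermite polynomials, as elements of `L²(N(0,1))`. -/
noncomputable def hermiteLp (n : ℕ) : Lp ℝ 2 (gaussianReal 0 1) :=
  (√(n.factorial : ℝ))⁻¹ • (memLp_eval_gaussianReal (realHermite n)).toLp _

lemma orthonormal_hermiteLp : Orthonormal ℝ hermiteLp := by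
  rw [orthonormal_iff_ite]
  intro i j
  rw [hermiteLp, hermiteLp, real_inner_smul_left, real_inner_smul_right, inner_toLp_two,
    integral_realHermite_mul]
  split_ifs with h
  · subst h
    have h0 : (0 : ℝ) < i.factorial := by exact_mod_cast i.factorial_pos
    have hs := Real.mul_self_sqrt h0.le
    have hs0 := Real.sqrt_pos.2 h0
    field_simp
    nlinarith
  · simp

/-- Orthogonality to all H_n propagates to all X^j H_n by induction on j, because X H_n = H_{n+1} +
H_n' and H_n' is a multiple of H_{n-1}. With n = 0 these are the monomials. -/
lemma orthogonal_span_hermiteLp : (Submodule.span ℝ (Set.range hermiteLp))ᗮ = ⊥ := by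
  rw [eq_bot_iff]
  intro f hf
  have hfm : MemLp f 2 (gaussianReal 0 1) := Lp.memLp f
  have h0 : ∀ n, ∫ x, (realHermite n).eval x * f x ∂(gaussianReal 0 1) = 0 := by
    intro n
    have h1 := (Submodule.mem_orthogonal _ _).1 hf (hermiteLp n)
      (Submodule.subset_span ⟨n, rfl⟩)
    have hn : (√(n.factorial : ℝ))⁻¹ ≠ 0 := by positivity
    rw [hermiteLp, real_inner_smul_left, mul_eq_zero, or_iff_right hn] at h1
    rw [← Lp.toLp_coeFn f hfm, inner_toLp_two] at h1
    exact h1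
  have hInt : ∀ P : ℝ[X], Integrable (fun x => P.eval x * f x) (gaussianReal 0 1) := fun P =>
    (memLp_eval_gaussianReal P).integrable_mul hfm
  have hder : ∀ j n, (∀ n, ∫ x, (X ^ j * realHermite n).eval x * f x ∂(gaussianReal 0 1) = 0) →
      ∫ x, (X ^ j * derivative (realHermite n)).eval x * f x ∂(gaussianReal 0 1) = 0 := by
    intro j n h
    cases n with
    | zero => simp [realHermite_zero]
    | succ n =>
      have e : ∀ x, (X ^ j * derivative (realHermite (n + 1))).eval x * f x =
          ((n : ℝ) + 1) * ((X ^ j * realHermite n).eval x * f x) := by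
        intro x
        rw [derivative_realHermite_succ]
        simp only [eval_mul, eval_add, eval_natCast, eval_one]
        ring
      simp_rw [e]
      rw [integral_const_mul, h n, mul_zero]
  have hall : ∀ j n, ∫ x, (X ^ j * realHermite n).eval x * f x ∂(gaussianReal 0 1) = 0 := by
    intro j
    induction j with
    | zero => simpa using h0
    | succ j ih =>
      intro n
      have e : ∀ x, (X ^ (j + 1) * realHermite n).eval x * f x =
          (X ^ j * realHermite (n + 1)).eval x * f x +
          (X ^ j * derivative (realHermite n)).eval x * f x := by
        intro x
        rw [realHermite_succ n]
        simp only [eval_mul, eval_sub, eval_pow, eval_X]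
        ring
      simp_rw [e]
      rw [integral_add (hInt _) (hInt _), ih, hder j n ih, add_zero]
  have := ae_eq_zero_of_integral_pow_mul_eq_zero hfm fun n => by
    simpa [realHermite_zero] using hall n 0
  rw [Submodule.mem_bot]
  exact (Lp.eq_zero_iff_ae_eq_zero).2 this

/-- The Hilbert basis of `L²(N(0,1))` given by the normalized Hermite polynomials. -/
noncomputable def hermiteBasis : HilbertBasis ℕ ℝ (Lp ℝ 2 (gaussianReal 0 1)) :=
  HilbertBasis.mkOfOrthogonalEqBot orthonormal_hermiteLp orthogonal_span_hermiteLp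

lemma hermiteBasis_apply (n : ℕ) : hermiteBasis n = hermiteLp n := by
  simp [hermiteBasis]

variable {m : ℕ}

/-- Composition with `x ↦ ⟨v, x⟩`, as an isometry `L²(N(0,1)) → L²(N(0,I))`. -/
noncomputable def liftDirection {v : EuclideanSpace ℝ (Fin m)} (hv : ‖v‖ = 1) :
    Lp ℝ 2 (gaussianReal 0 1) →ₗᵢ[ℝ] Lp ℝ 2 (stdGaussian (EuclideanSpace ℝ (Fin m))) :=
  Lp.compMeasurePreservingₗᵢ ℝ _ (measurePreserving_inner hv)

lemma liftDirection_toLp {v : EuclideanSpace ℝ (Fin m)} (hv : ‖v‖ = 1) {f : ℝ → ℝ}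
    (hf : MemLp f 2 (gaussianReal 0 1)) :
    liftDirection hv (hf.toLp f) =
      (hf.comp_measurePreserving (measurePreserving_inner hv)).toLp _ := rfl

lemma inner_liftDirection_hermiteLp {u v : EuclideanSpace ℝ (Fin m)} (hu : ‖u‖ = 1)
    (hv : ‖v‖ = 1) (k n : ℕ) :
    inner ℝ (liftDirection hu (hermiteLp k)) (liftDirection hv (hermiteLp n)) =
      if k = n then inner ℝ u v ^ n else 0 := by
  rw [hermiteLp, hermiteLp, map_smul, map_smul, liftDirection_toLp, liftDirection_toLp,
    real_inner_smul_left, real_inner_smul_right, inner_toLp_two]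
  simp only [Function.comp_apply]
  rw [integral_realHermite_inner_mul k n hu hv]
  split_ifs with h
  · subst h
    have h0 : (0 : ℝ) < k.factorial := by exact_mod_cast k.factorial_pos
    have hs := Real.mul_self_sqrt h0.le
    have hs0 := Real.sqrt_pos.2 h0
    have e : (√(k.factorial : ℝ))⁻¹ * ((√(k.factorial : ℝ))⁻¹ *
      ((k.factorial : ℝ) * inner ℝ u v ^ k)) = (k.factorial : ℝ) /
        (√(k.factorial : ℝ) * √(k.factorial : ℝ)) * inner ℝ u v ^ k := by
      field_simp
    rw [e, hs, div_self h0.ne', one_mul]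
  · simp

/-- Lifts of distinct Hermite functions along any two directions are orthogonal, so only the
diagonal survives when f is expanded on both sides; the n-th diagonal entry is ⟨u,v⟩^n. -/
lemma hasSum_inner_liftDirection {u v : EuclideanSpace ℝ (Fin m)} (hu : ‖u‖ = 1)
    (hv : ‖v‖ = 1) (f : Lp ℝ 2 (gaussianReal 0 1)) :
    HasSum (fun n => inner ℝ (hermiteLp n) f ^ 2 * inner ℝ u v ^ n)
      (inner ℝ (liftDirection hu f) (liftDirection hv f)) := by
  have hrep : HasSum (fun n => inner ℝ (hermiteLp n) f • hermiteLp n) f := by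
    simpa [HilbertBasis.repr_apply_apply, hermiteBasis_apply] using hermiteBasis.hasSum_repr f
  have hleft : ∀ n, inner ℝ (liftDirection hu f) (liftDirection hv (hermiteLp n)) =
      inner ℝ (hermiteLp n) f * inner ℝ u v ^ n := by
    intro n
    have h1 := (hrep.mapL (liftDirection hu).toContinuousLinearMap).mapL
      (innerSL ℝ (liftDirection hv (hermiteLp n)))
    simp only [LinearIsometry.coe_toContinuousLinearMap, map_smul, innerSL_apply_apply,
      smul_eq_mul] at h1
    have h2 := hasSum_single (f := fun k => inner ℝ (hermiteLp k) f *
      inner ℝ (liftDirection hv (hermiteLp n)) (liftDirection hu (hermiteLp k))) n (by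
        intro k hk
        rw [inner_liftDirection_hermiteLp, if_neg (Ne.symm hk), mul_zero])
    rw [real_inner_comm, h1.unique h2, inner_liftDirection_hermiteLp, if_pos rfl,
      real_inner_comm u v]
  have h3 := (hrep.mapL (liftDirection hv).toContinuousLinearMap).mapL
      (innerSL ℝ (liftDirection hu f))
  simp only [LinearIsometry.coe_toContinuousLinearMap, map_smul, innerSL_apply_apply,
      smul_eq_mul, hleft] at h3
  refine h3.congr_fun ?_
  intro n
  ring

lemma hasSum_inner_hermiteLp_sq (f : Lp ℝ 2 (gaussianReal 0 1)) :
    HasSum (fun n => inner ℝ (hermiteLp n) f ^ 2) (‖f‖ ^ 2) := by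
  have := hermiteBasis.hasSum_inner_mul_inner f f
  rw [real_inner_self_eq_norm_sq] at this
  simp only [hermiteBasis_apply] at this
  refine this.congr_fun ?_
  intro n
  rw [real_inner_comm f, sq]

end HermiteBasis

/-! ### Centered densities: chi-square norm, Hermite coefficients, correlations -/

section ChiSquare

open Polynomial

variable {m : ℕ} {A : Measure ℝ}

/-- The density `dA/dN(0,1)` minus one. -/
noncomputable def centeredDensity (A : Measure ℝ) (x : ℝ) : ℝ :=
  (A.rnDeriv (gaussianReal 0 1) x).toReal - 1

lemma absolutelyContinuous_of_chiSqDiv_ne_top {X : Type*} [MeasurableSpace X] {A B : Measure X}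
    (h : chiSqDiv A B ≠ ∞) : A ≪ B := by
  by_contra hA
  exact h (by simp [chiSqDiv, hA])

lemma lintegral_rnDeriv_sq_le {X : Type*} [MeasurableSpace X] {A B : Measure X}
    (h : chiSqDiv A B ≠ ∞) : ∫⁻ x, A.rnDeriv B x ^ 2 ∂B ≤ chiSqDiv A B + 1 := by
  rw [chiSqDiv, if_pos (absolutelyContinuous_of_chiSqDiv_ne_top h)]
  exact le_tsub_add

lemma lintegral_rnDeriv_sq_ne_top {X : Type*} [MeasurableSpace X] {A B : Measure X}
    (h : chiSqDiv A B ≠ ∞) : ∫⁻ x, A.rnDeriv B x ^ 2 ∂B ≠ ∞ :=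
  ne_top_of_le_ne_top (by finiteness) (lintegral_rnDeriv_sq_le h)

lemma memLp_rnDeriv (h : chiSqDiv A (gaussianReal 0 1) ≠ ∞) :
    MemLp (fun x => (A.rnDeriv (gaussianReal 0 1) x).toReal) 2 (gaussianReal 0 1) := by
  have hm := (Measure.measurable_rnDeriv A (gaussianReal 0 1))
  refine (memLp_two_iff_integrable_sq hm.ennreal_toReal.aestronglyMeasurable).2 ?_
  simpa using integrable_toReal_of_lintegral_ne_top (hm.pow_const 2).aemeasurable
    (lintegral_rnDeriv_sq_ne_top h)

lemma memLp_centeredDensity (h : chiSqDiv A (gaussianReal 0 1) ≠ ∞) :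
    MemLp (centeredDensity A) 2 (gaussianReal 0 1) :=
  (memLp_rnDeriv h).sub (memLp_const 1)

/-- `dA/dN(0,1) - 1` as an element of `L²(N(0,1))`. -/
noncomputable def centeredDensityLp (h : chiSqDiv A (gaussianReal 0 1) ≠ ∞) :
    Lp ℝ 2 (gaussianReal 0 1) :=
  (memLp_centeredDensity h).toLp _

/-- With φ the density, which has mean 1, ∫(φ - 1)² = ∫φ² - 1. An upper bound is all that is used,
so the truncated subtraction in `chiSqDiv` does no harm. -/
lemma norm_centeredDensityLp_sq_le [IsProbabilityMeasure A]
    (h : chiSqDiv A (gaussianReal 0 1) ≠ ∞) :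
    ‖centeredDensityLp h‖ ^ 2 ≤ (chiSqDiv A (gaussianReal 0 1)).toReal := by
  have hA := absolutelyContinuous_of_chiSqDiv_ne_top h
  have hm := (Measure.measurable_rnDeriv A (gaussianReal 0 1))
  have hφ := memLp_rnDeriv h
  have hi : Integrable (fun x => (A.rnDeriv (gaussianReal 0 1) x).toReal) (gaussianReal 0 1) :=
    hφ.integrable (by norm_num)
  have h1 : ∫ x, (A.rnDeriv (gaussianReal 0 1) x).toReal ∂(gaussianReal 0 1) = 1 := by
    simpa using integral_rnDeriv_smul (μ := A) (ν := gaussianReal 0 1) hA (f := fun _ => (1 : ℝ))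
  have h2 : ∫ x, (A.rnDeriv (gaussianReal 0 1) x).toReal ^ 2 ∂(gaussianReal 0 1) ≤
      (chiSqDiv A (gaussianReal 0 1)).toReal + 1 := by
    have e := integral_toReal (hm.pow_const 2).aemeasurable
      (ae_lt_top (hm.pow_const 2) (lintegral_rnDeriv_sq_ne_top h))
    simp only [ENNReal.toReal_pow] at e
    rw [e]
    have := ENNReal.toReal_mono (by finiteness) (lintegral_rnDeriv_sq_le h)
    rwa [ENNReal.toReal_add h (by simp), ENNReal.toReal_one] at this
  rw [← real_inner_self_eq_norm_sq, centeredDensityLp, inner_toLp_two]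
  have e : ∀ x, centeredDensity A x * centeredDensity A x =
      (A.rnDeriv (gaussianReal 0 1) x).toReal ^ 2 -
        (2 * (A.rnDeriv (gaussianReal 0 1) x).toReal - 1) := by
    intro x; rw [centeredDensity]; ring
  simp_rw [e]
  have hlin : Integrable (fun x => 2 * (A.rnDeriv (gaussianReal 0 1) x).toReal - 1)
      (gaussianReal 0 1) := (hi.const_mul 2).sub (integrable_const 1)
  rw [integral_sub hφ.integrable_sq hlin,
    integral_sub (hi.const_mul 2) (integrable_const 1), integral_const_mul, h1]
  simp only [integral_const, probReal_univ, smul_eq_mul]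
  linarith

lemma integrable_of_memLp_two [IsProbabilityMeasure A]
    (h : chiSqDiv A (gaussianReal 0 1) ≠ ∞) {f : ℝ → ℝ}
    (hf : MemLp f 2 (gaussianReal 0 1)) : Integrable f A := by
  rw [← integrable_rnDeriv_smul_iff (absolutelyContinuous_of_chiSqDiv_ne_top h)]
  exact (memLp_rnDeriv h).integrable_mul hf

lemma integral_sub_integral_eq [IsProbabilityMeasure A]
    (h : chiSqDiv A (gaussianReal 0 1) ≠ ∞) {f : ℝ → ℝ}
    (hf : MemLp f 2 (gaussianReal 0 1)) :
    ∫ x, f x ∂A - ∫ x, f x ∂(gaussianReal 0 1) =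
      ∫ x, f x * centeredDensity A x ∂(gaussianReal 0 1) := by
  have hφf : Integrable (fun x => (A.rnDeriv (gaussianReal 0 1) x).toReal • f x)
      (gaussianReal 0 1) := (memLp_rnDeriv h).integrable_mul hf
  rw [← integral_rnDeriv_smul (absolutelyContinuous_of_chiSqDiv_ne_top h),
    ← integral_sub hφf (hf.integrable (by norm_num))]
  congr 1
  ext x
  simp only [smul_eq_mul, centeredDensity]
  ring

/-- The coefficient is Λ(H_n)/√n!, where Λ is the difference of expectations under A and N(0,1). The
moment hypothesis bounds Λ on monomials up to degree k; degree 0 is free because both have mass one.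
-/
lemma abs_inner_hermiteLp_centeredDensityLp_le [IsProbabilityMeasure A] {k : ℕ} {ν : ℝ} (hν : 0 ≤ ν)
    (h : chiSqDiv A (gaussianReal 0 1) ≠ ∞) (hk : MatchesGaussianMoments k ν A) {n : ℕ}
    (hn : n ≤ k) : |inner ℝ (hermiteLp n) (centeredDensityLp h)| ≤ ν * 2 ^ n := by
  have hPA : ∀ P : ℝ[X], Integrable (fun x => P.eval x) A := fun P =>
    integrable_of_memLp_two h (memLp_eval_gaussianReal P)
  let Λ : ℝ[X] →ₗ[ℝ] ℝ :=
    { toFun := fun P => ∫ x, P.eval x ∂A - ∫ x, P.eval x ∂(gaussianReal 0 1)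
      map_add' := by
        intro P Q
        simp only [eval_add]
        rw [integral_add (hPA P) (hPA Q), integral_add (integrable_eval_gaussianReal P)
          (integrable_eval_gaussianReal Q)]
        ring
      map_smul' := by
        intro c P
        simp only [eval_smul, smul_eq_mul, integral_const_mul, RingHom.id_apply]
        ring }
  have hΛ : ∀ P : ℝ[X], Λ P = ∫ x, P.eval x ∂A - ∫ x, P.eval x ∂(gaussianReal 0 1) :=
    fun P => rfl
  have hmom : ∀ j ≤ k, |Λ (X ^ j)| ≤ ν := by
    intro j hj
    rw [hΛ]
    rcases Nat.eq_zero_or_pos j with rfl | hj0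
    · simpa using hν
    · simpa using hk j hj0 hj
  have hb := abs_apply_realHermite_le hmom n 0 (by omega)
  rw [pow_zero, one_mul, hΛ, integral_sub_integral_eq h (memLp_eval_gaussianReal _)] at hb
  rw [hermiteLp, real_inner_smul_left, centeredDensityLp, inner_toLp_two, abs_mul]
  have hf : 0 < √(n.factorial : ℝ) := Real.sqrt_pos.2 (by exact_mod_cast n.factorial_pos)
  rw [abs_of_pos (inv_pos.2 hf), inv_mul_le_iff₀ hf]
  linarith

/-- The correlation of two hidden direction distributions whose directions are nearly
orthogonal. -/
lemma inner_liftDirection_centeredDensityLp_le [IsProbabilityMeasure A]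
    {k : ℕ} {ν c : ℝ} (hν : 0 ≤ ν) (hc : 0 ≤ c)
    (hc1 : c ≤ 1) (h : chiSqDiv A (gaussianReal 0 1) ≠ ∞) (hk : MatchesGaussianMoments k ν A)
    {u v : EuclideanSpace ℝ (Fin m)} (hu : ‖u‖ = 1) (hv : ‖v‖ = 1)
    (huv : |inner ℝ u v| ≤ c / 8) :
    inner ℝ (liftDirection hu (centeredDensityLp h)) (liftDirection hv (centeredDensityLp h)) ≤
      ν ^ 2 + (chiSqDiv A (gaussianReal 0 1)).toReal * c ^ k := by
  have hs := hasSum_inner_liftDirection hu hv (centeredDensityLp h)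
  have hn := hasSum_inner_hermiteLp_sq (centeredDensityLp h)
  -- The majorant is 2^{-n} for n ≥ 1 and 0 at n = 0. Dropping n = 0 makes the total exactly ν²
  -- rather than 2ν², which is allowed because the constant Hermite coefficient vanishes.
  have hg : HasSum (fun n : ℕ => (1 / 2 : ℝ) ^ n - if n = 0 then 1 else 0) 1 := by
    have := hasSum_geometric_two.sub (hasSum_ite_eq 0 (1 : ℝ))
    rwa [show (2 : ℝ) - 1 = 1 by norm_num] at this
  have hb := (hg.mul_left (ν ^ 2)).add (hn.mul_right (c ^ k))
  refine (hasSum_le (fun n => ?_) hs hb).trans ?_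
  · set b := inner ℝ (hermiteLp n) (centeredDensityLp h) with hbdef
    set θ : ℝ := inner ℝ u v
    have hθ : b ^ 2 * θ ^ n ≤ b ^ 2 * |θ| ^ n := by
      refine mul_le_mul_of_nonneg_left ?_ (sq_nonneg b)
      rw [← abs_pow]; exact le_abs_self _
    refine hθ.trans ?_
    have hck : 0 ≤ b ^ 2 * c ^ k := by positivity
    rcases Nat.eq_zero_or_pos n with h0 | h0
    · have hb0 : b = 0 := by
        have e : hermiteLp 0 = (memLp_const (1 : ℝ)).toLp _ := by
          simp [hermiteLp, realHermite_zero]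
        have := integral_sub_integral_eq h (memLp_const (1 : ℝ))
        rw [hbdef, h0, e, centeredDensityLp, inner_toLp_two, ← this]
        simp
      simp [hb0, h0]
    rw [if_neg h0.ne', sub_zero]
    -- For n ≤ k the moments give b² ≤ ν² 4^n, and |θ| ≤ 1/8 turns this into ν² 2^{-n}; this is
    -- where the 8 in c/8 comes from. For n > k, |θ|^n ≤ c^k, and the b² sum to at most χ².
    by_cases hnk : n ≤ k
    · have hbn := abs_inner_hermiteLp_centeredDensityLp_le hν h hk hnk
      have hb2 : b ^ 2 ≤ (ν * 2 ^ n) ^ 2 := by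
        rw [← sq_abs]
        gcongr
      have ht : |θ| ^ n ≤ (1 / 8) ^ n := by
        gcongr
        linarith
      calc b ^ 2 * |θ| ^ n ≤ (ν * 2 ^ n) ^ 2 * (1 / 8) ^ n := by gcongr
        _ = ν ^ 2 * ((2 * 2 * (1 / 8)) ^ n) := by
          rw [mul_pow, mul_pow, mul_pow]; ring
        _ = ν ^ 2 * (1 / 2) ^ n := by norm_num
        _ ≤ _ := by linarith
    · have ht : |θ| ^ n ≤ c ^ k := by
        calc |θ| ^ n ≤ c ^ n := by gcongr; linarith
          _ ≤ c ^ k := pow_le_pow_of_le_one hc hc1 (by omega)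
      have : b ^ 2 * |θ| ^ n ≤ b ^ 2 * c ^ k := by gcongr
      have h2 : 0 ≤ ν ^ 2 * (1 / 2 : ℝ) ^ n := by positivity
      linarith
  · have := norm_centeredDensityLp_sq_le h
    have hck : 0 ≤ c ^ k := by positivity
    nlinarith

lemma inner_liftDirection_centeredDensityLp_le_chiSqDiv [IsProbabilityMeasure A]
    (h : chiSqDiv A (gaussianReal 0 1) ≠ ∞)
    {u v : EuclideanSpace ℝ (Fin m)} (hu : ‖u‖ = 1) (hv : ‖v‖ = 1) :
    inner ℝ (liftDirection hu (centeredDensityLp h)) (liftDirection hv (centeredDensityLp h)) ≤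
      (chiSqDiv A (gaussianReal 0 1)).toReal := by
  refine (real_inner_le_norm _ _).trans ?_
  rw [LinearIsometry.norm_map, LinearIsometry.norm_map, ← sq]
  exact norm_centeredDensityLp_sq_le h

lemma integral_hiddenDirection_sub [IsProbabilityMeasure A] (h : chiSqDiv A (gaussianReal 0 1) ≠ ∞)
    {v : EuclideanSpace ℝ (Fin m)} (hv : ‖v‖ = 1) {f : EuclideanSpace ℝ (Fin m) → ℝ}
    (hf : MemLp f 2 (stdGaussian (EuclideanSpace ℝ (Fin m)))) :
    ∫ x, f x ∂(hiddenDirection A v) - ∫ x, f x ∂(stdGaussian (EuclideanSpace ℝ (Fin m))) =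
      inner ℝ (hf.toLp f) (liftDirection hv (centeredDensityLp h)) := by
  have hA := absolutelyContinuous_of_chiSqDiv_ne_top h
  have hmp := measurePreserving_inner hv
  have hm : Measurable fun x => A.rnDeriv (gaussianReal 0 1) (inner ℝ v x) :=
    (Measure.measurable_rnDeriv A (gaussianReal 0 1)).comp hmp.measurable
  have hφf : Integrable (fun x => (A.rnDeriv (gaussianReal 0 1) (inner ℝ v x)).toReal • f x)
      (stdGaussian (EuclideanSpace ℝ (Fin m))) :=
    ((memLp_rnDeriv h).comp_measurePreserving hmp).integrable_mul hf
  have hlt : ∀ᵐ x ∂(stdGaussian (EuclideanSpace ℝ (Fin m))),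
      A.rnDeriv (gaussianReal 0 1) (inner ℝ v x) < ∞ :=
    hmp.quasiMeasurePreserving.ae (Measure.rnDeriv_lt_top A (gaussianReal 0 1))
  rw [hiddenDirection_eq_withDensity hA hv,
    integral_withDensity_eq_integral_toReal_smul hm hlt, centeredDensityLp, liftDirection_toLp,
    inner_toLp_two, ← integral_sub hφf
      (hf.integrable (by norm_num))]
  congr 1
  ext x
  simp only [smul_eq_mul, centeredDensity, Function.comp_apply]
  ring

end ChiSquare

/-! ### How many directions a single query can separate from the null -/

section QueryDifference

variable {m : ℕ} {A B : Measure ℝ}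

/-- The expectation of a query when `x` is standard Gaussian and independent of the label. -/
noncomputable def nullMean (p : ℝ) (f : StatQuery (Example m)) : ℝ :=
  p * ∫ x, f.toFun (x, 1) ∂(stdGaussian (EuclideanSpace ℝ (Fin m))) +
    (1 - p) * ∫ x, f.toFun (x, -1) ∂(stdGaussian (EuclideanSpace ℝ (Fin m)))

lemma StatQuery.measurable_slice (f : StatQuery (Example m)) (y : ℤˣ) :
    Measurable fun x => f.toFun (x, y) :=
  f.measurable_toFun.comp (by fun_prop)

lemma StatQuery.integrable_slice (f : StatQuery (Example m)) (y : ℤˣ)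
    (μ : Measure (EuclideanSpace ℝ (Fin m))) [IsFiniteMeasure μ] :
    Integrable (fun x => f.toFun (x, y)) μ :=
  .of_bound (f.measurable_slice y).aestronglyMeasurable 1
    (Filter.Eventually.of_forall fun _ => f.abs_le_one _)

lemma StatQuery.memLp_slice (f : StatQuery (Example m)) (y : ℤˣ) :
    MemLp (fun x => f.toFun (x, y)) 2 (stdGaussian (EuclideanSpace ℝ (Fin m))) :=
  .of_bound (f.measurable_slice y).aestronglyMeasurable 1
    (Filter.Eventually.of_forall fun _ => f.abs_le_one _)

lemma StatQuery.norm_toLp_slice_le (f : StatQuery (Example m)) (y : ℤˣ) :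
    ‖(f.memLp_slice y).toLp _‖ ≤ 1 := by
  have h := Lp.norm_le_of_ae_bound (f := (f.memLp_slice y).toLp _) (C := 1) zero_le_one (by
    filter_upwards [(f.memLp_slice y).coeFn_toLp] with x hx
    rw [hx]
    exact f.abs_le_one _)
  simpa [measureUnivNNReal] using h

instance isProbabilityMeasure_hiddenDirection [IsProbabilityMeasure A]
    (v : EuclideanSpace ℝ (Fin m)) : IsProbabilityMeasure (hiddenDirection A v) :=
  Measure.isProbabilityMeasure_map (measurable_hiddenDirection_map v).aemeasurable

lemma integral_hiddenDirectionLabelled [IsProbabilityMeasure A] [IsProbabilityMeasure B] {p : ℝ}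
    (hp : 0 ≤ p) (hp1 : p ≤ 1) (v : EuclideanSpace ℝ (Fin m)) (f : StatQuery (Example m)) :
    ∫ z, f.toFun z ∂(hiddenDirectionLabelled A B p v) =
      p * ∫ x, f.toFun (x, 1) ∂(hiddenDirection A v) +
        (1 - p) * ∫ x, f.toFun (x, -1) ∂(hiddenDirection B v) := by
  have hm : ∀ y : ℤˣ, Measurable fun x : EuclideanSpace ℝ (Fin m) => (x, y) := fun y => by fun_prop
  have hi : ∀ (y : ℤˣ) (C : Measure ℝ) [IsProbabilityMeasure C],
      Integrable f.toFun ((hiddenDirection C v).map (fun x => (x, y))) := fun y C _ =>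
    (integrable_map_measure f.measurable_toFun.aestronglyMeasurable (hm y).aemeasurable).2
      (f.integrable_slice y _)
  rw [hiddenDirectionLabelled, integral_add_measure ((hi 1 A).smul_measure ENNReal.ofReal_ne_top)
    ((hi (-1) B).smul_measure ENNReal.ofReal_ne_top), integral_smul_measure, integral_smul_measure,
    integral_map (hm 1).aemeasurable f.measurable_toFun.aestronglyMeasurable,
    integral_map (hm (-1)).aemeasurable f.measurable_toFun.aestronglyMeasurable,
    ENNReal.toReal_ofReal hp, ENNReal.toReal_ofReal (by linarith), smul_eq_mul, smul_eq_mul]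

lemma integral_hiddenDirectionLabelled_sub_nullMean [IsProbabilityMeasure A]
    [IsProbabilityMeasure B] {p : ℝ} (hp : 0 ≤ p) (hp1 : p ≤ 1)
    (hA : chiSqDiv A (gaussianReal 0 1) ≠ ∞) (hB : chiSqDiv B (gaussianReal 0 1) ≠ ∞)
    {v : EuclideanSpace ℝ (Fin m)} (hv : ‖v‖ = 1) (f : StatQuery (Example m)) :
    ∫ z, f.toFun z ∂(hiddenDirectionLabelled A B p v) - nullMean p f =
      p * inner ℝ ((f.memLp_slice 1).toLp _) (liftDirection hv (centeredDensityLp hA)) +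
      (1 - p) *
        inner ℝ ((f.memLp_slice (-1)).toLp _) (liftDirection hv (centeredDensityLp hB)) := by
  rw [integral_hiddenDirectionLabelled hp hp1, nullMean,
    ← integral_hiddenDirection_sub hA hv (f.memLp_slice 1),
    ← integral_hiddenDirection_sub hB hv (f.memLp_slice (-1))]
  ring

/-- Cauchy–Schwarz against the whole sum: its squared norm is the double sum of correlations, so one
bounded w cannot correlate consistently with many nearly uncorrelated vectors. -/
lemma inner_sum_le_sqrt {E ι : Type*} [NormedAddCommGroup E] [InnerProductSpace ℝ E]
    {w : E} (hw : ‖w‖ ≤ 1) (S : Finset ι) (F : ι → E) {M : ℝ}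
    (hM : ∑ i ∈ S, ∑ j ∈ S, inner ℝ (F i) (F j) ≤ M) :
    |∑ i ∈ S, inner ℝ w (F i)| ≤ √M := by
  rw [← inner_sum]
  refine (abs_real_inner_le_norm _ _).trans ?_
  have h1 : ‖∑ i ∈ S, F i‖ ^ 2 ≤ M := by
    rw [← real_inner_self_eq_norm_sq, sum_inner]
    simp_rw [inner_sum]
    exact hM
  calc ‖w‖ * ‖∑ i ∈ S, F i‖ ≤ 1 * ‖∑ i ∈ S, F i‖ := by gcongr
    _ ≤ √M := by rw [one_mul]; exact Real.le_sqrt_of_sq_le h1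

/-- Each row pays α for at most b bad entries and ρ for every entry. Only upper bounds on the
entries matter, since the sum is itself bounded only from above. -/
lemma sum_sum_le_of_row_card_le {ι : Type*} [Fintype ι] {q : ι → ι → ℝ}
    {bad : ι → ι → Prop} [∀ i, DecidablePred (bad i)] {α ρ b : ℝ} (hα : 0 ≤ α) (hρ : 0 ≤ ρ)
    (hq : ∀ i j, q i j ≤ α) (hq' : ∀ i j, ¬ bad i j → q i j ≤ ρ)
    (hb : ∀ i, ((Finset.univ.filter (bad i)).card : ℝ) ≤ b) (S : Finset ι) :
    ∑ i ∈ S, ∑ j ∈ S, q i j ≤ S.card * (b * α) + (S.card : ℝ) ^ 2 * ρ := by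
  have hrow : ∀ i ∈ S, ∑ j ∈ S, q i j ≤ b * α + S.card * ρ := by
    intro i _
    have h1 : ∀ j ∈ S, q i j ≤ (if bad i j then α else 0) + ρ := by
      intro j _
      split_ifs with h
      · linarith [hq i j]
      · linarith [hq' i j h]
    refine (Finset.sum_le_sum h1).trans ?_
    rw [Finset.sum_add_distrib, Finset.sum_const, nsmul_eq_mul, ← Finset.sum_filter,
      Finset.sum_const, nsmul_eq_mul]
    gcongr
    refine le_trans ?_ (hb i)
    exact_mod_cast Finset.card_le_card (Finset.filter_subset_filter _ (Finset.subset_univ S))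
  refine (Finset.sum_le_sum hrow).trans (le_of_eq ?_)
  rw [Finset.sum_const, nsmul_eq_mul]
  ring

lemma abs_sum_integral_sub_nullMean_le {ι : Type*} [IsProbabilityMeasure A]
    [IsProbabilityMeasure B] {p : ℝ} (hp : 0 ≤ p) (hp1 : p ≤ 1)
    (hA : chiSqDiv A (gaussianReal 0 1) ≠ ∞) (hB : chiSqDiv B (gaussianReal 0 1) ≠ ∞)
    {V : ι → EuclideanSpace ℝ (Fin m)} (hV : ∀ i, ‖V i‖ = 1) (f : StatQuery (Example m))
    (S : Finset ι) {M : ℝ}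
    (hMA : ∑ i ∈ S, ∑ j ∈ S, inner ℝ (liftDirection (hV i) (centeredDensityLp hA))
      (liftDirection (hV j) (centeredDensityLp hA)) ≤ M)
    (hMB : ∑ i ∈ S, ∑ j ∈ S, inner ℝ (liftDirection (hV i) (centeredDensityLp hB))
      (liftDirection (hV j) (centeredDensityLp hB)) ≤ M) :
    |∑ i ∈ S, (∫ z, f.toFun z ∂(hiddenDirectionLabelled A B p (V i)) - nullMean p f)| ≤ √M := by
  simp_rw [fun i => integral_hiddenDirectionLabelled_sub_nullMean hp hp1 hA hB (hV i) f]
  rw [Finset.sum_add_distrib, ← Finset.mul_sum, ← Finset.mul_sum]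
  have h1 := inner_sum_le_sqrt (f.norm_toLp_slice_le 1) S _ hMA
  have h2 := inner_sum_le_sqrt (f.norm_toLp_slice_le (-1)) S _ hMB
  refine (abs_add_le _ _).trans ?_
  rw [abs_mul, abs_mul, abs_of_nonneg hp, abs_of_nonneg (by linarith : 0 ≤ 1 - p)]
  calc _ ≤ p * √M + (1 - p) * √M := by gcongr
    _ = √M := by ring

open Classical in
/-- Few of the distributions in the family are distinguished from the null distribution by a given
query of accuracy `2√ρ`. -/
lemma card_distinguished_le {ι : Type*} [Fintype ι] [IsProbabilityMeasure A]
    [IsProbabilityMeasure B] {p α ρ b η : ℝ} (hp : 0 ≤ p) (hp1 : p ≤ 1)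
    (hA : chiSqDiv A (gaussianReal 0 1) ≠ ∞) (hB : chiSqDiv B (gaussianReal 0 1) ≠ ∞)
    (hρ : 0 < ρ) (hα : 0 ≤ α) (hb0 : 0 ≤ b)
    {V : ι → EuclideanSpace ℝ (Fin m)} (hV : ∀ i, ‖V i‖ = 1)
    (hb : ∀ i, ((Finset.univ.filter fun j => η < |inner ℝ (V i) (V j)|).card : ℝ) ≤ b)
    (hAα : (chiSqDiv A (gaussianReal 0 1)).toReal ≤ α)
    (hBα : (chiSqDiv B (gaussianReal 0 1)).toReal ≤ α)
    (hAρ : ∀ i j, |inner ℝ (V i) (V j)| ≤ η →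
      inner ℝ (liftDirection (hV i) (centeredDensityLp hA))
        (liftDirection (hV j) (centeredDensityLp hA)) ≤ ρ)
    (hBρ : ∀ i j, |inner ℝ (V i) (V j)| ≤ η →
      inner ℝ (liftDirection (hV i) (centeredDensityLp hB))
        (liftDirection (hV j) (centeredDensityLp hB)) ≤ ρ)
    (f : StatQuery (Example m)) :
    ((Finset.univ.filter fun i => 2 * √ρ <
      |∫ z, f.toFun z ∂(hiddenDirectionLabelled A B p (V i)) - nullMean p f|).card : ℝ) ≤
      2 * (b * α / (3 * ρ)) := by
  set d : ι → ℝ := fun i => ∫ z, f.toFun z ∂(hiddenDirectionLabelled A B p (V i)) - nullMean p f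
    with hd
  -- Squaring |S| · 2√ρ ≤ √(|S| b α + |S|² ρ) gives 3ρ |S| ≤ b α. Accuracy 2√ρ instead of √ρ is what
  -- leaves the margin 3ρ.
  have key : ∀ S : Finset ι, S.card * (2 * √ρ) ≤ |∑ i ∈ S, d i| →
      (S.card : ℝ) ≤ b * α / (3 * ρ) := by
    intro S hS
    have hMA := sum_sum_le_of_row_card_le (bad := fun i j => η < |inner ℝ (V i) (V j)|) hα hρ.le
      (fun i j => (inner_liftDirection_centeredDensityLp_le_chiSqDiv hA (hV i) (hV j)).trans hAα)
      (fun i j h => hAρ i j (not_lt.1 h)) hb S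
    have hMB := sum_sum_le_of_row_card_le (bad := fun i j => η < |inner ℝ (V i) (V j)|) hα hρ.le
      (fun i j => (inner_liftDirection_centeredDensityLp_le_chiSqDiv hB (hV i) (hV j)).trans hBα)
      (fun i j h => hBρ i j (not_lt.1 h)) hb S
    have h1 := hS.trans (abs_sum_integral_sub_nullMean_le hp hp1 hA hB hV f S hMA hMB)
    have hs := Real.sq_sqrt hρ.le
    rcases S.eq_empty_or_nonempty with rfl | hne
    · simp only [Finset.card_empty, Nat.cast_zero]
      positivity
    have hc : (0 : ℝ) < S.card := by exact_mod_cast hne.card_pos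
    have h2 := (Real.le_sqrt (by positivity) (by positivity)).1 h1
    have h3 : (S.card : ℝ) * (S.card * (3 * ρ)) ≤ S.card * (b * α) := by
      nlinarith
    rw [le_div_iff₀ (by positivity)]
    exact le_of_mul_le_mul_left h3 hc
  -- Deviations of opposite sign could cancel in the sum, so the two signs are treated separately;
  -- hence the factor 2.
  have hpos := key (Finset.univ.filter fun i => 2 * √ρ < d i) (by
    refine le_trans ?_ (le_abs_self _)
    rw [← nsmul_eq_mul]
    exact Finset.card_nsmul_le_sum _ _ _ fun i hi => (Finset.mem_filter.1 hi).2.le)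
  have hneg := key (Finset.univ.filter fun i => 2 * √ρ < -d i) (by
    refine le_trans ?_ (neg_le_abs _)
    rw [← nsmul_eq_mul, ← Finset.sum_neg_distrib]
    exact Finset.card_nsmul_le_sum _ _ _ fun i hi => (Finset.mem_filter.1 hi).2.le)
  have hsub : (Finset.univ.filter fun i => 2 * √ρ < |d i|) ⊆
      (Finset.univ.filter fun i => 2 * √ρ < d i) ∪
        (Finset.univ.filter fun i => 2 * √ρ < -d i) := by
    intro i hi
    simpa [lt_abs] using hi
  have h4 : ((Finset.univ.filter fun i => 2 * √ρ < |d i|).card : ℝ) ≤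
      (Finset.univ.filter fun i => 2 * √ρ < d i).card +
        (Finset.univ.filter fun i => 2 * √ρ < -d i).card := by
    exact_mod_cast (Finset.card_le_card hsub).trans (Finset.card_union_le _ _)
  linarith

end QueryDifference

/-! ### The adversarial oracle and the reduction to counting separated directions -/

section Adversary

open Classical in
/-- The oracle for `D` that answers by `c f` whenever that is a valid answer. -/
noncomputable def adversarialOracle {X : Type} [MeasurableSpace X] (c : StatQuery X → ℝ)
    (D : Measure X) (f : StatQuery X) : ℝ :=
  if |c f - ∫ x, f.toFun x ∂D| ≤ f.accuracy then c f else ∫ x, f.toFun x ∂D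

lemma isSQOracle_adversarialOracle {X : Type} [MeasurableSpace X] (c : StatQuery X → ℝ)
    (D : Measure X) : IsSQOracle D (adversarialOracle c D) := by
  intro f
  unfold adversarialOracle
  split_ifs with h
  · exact h
  · simpa using f.accuracy_pos.le

open Classical in
/-- If every query of accuracy at least `τ` distinguishes at most `K` of the distributions `D i`
from the reference answers `c`, then the adversarial oracles for most of the `D i` lead the
algorithm to the output that it has on the reference answers. -/
lemma SQAlgorithm.card_run_eq {X : Type} [MeasurableSpace X] {H : Type} {ι : Type*}
    [Fintype ι]
    {c : StatQuery X → ℝ} {D : ι → Measure X} {K τ : ℝ}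
    (hK : ∀ f : StatQuery X,
      ((Finset.univ.filter fun i => τ < |∫ x, f.toFun x ∂(D i) - c f|).card : ℝ) ≤ K)
    (a : SQAlgorithm X H) (W : Finset ι) (T : ℝ) (hT : 0 ≤ T) (hTW : T < W.card)
    (hacc : ∀ i ∈ W, ∀ f ∈ a.queries (adversarialOracle c (D i)), τ ≤ f.accuracy)
    (hlen : ∀ i ∈ W, K * (a.queries (adversarialOracle c (D i))).length ≤ T) :
    (W.card : ℝ) - T ≤
      (W.filter fun i => a.run (adversarialOracle c (D i)) = a.run c).card := by
  induction a generalizing W T with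
  | output h => simpa [SQAlgorithm.run] using hT
  | query f next ih =>
    have hK0 : 0 ≤ K := (Nat.cast_nonneg _).trans (hK f)
    -- The accuracy and length hypotheses speak only of members of W, so a member is needed to use
    -- them for this query; T < |W| provides one and survives the induction.
    have hne : W.Nonempty := by
      rw [← Finset.card_pos]
      exact_mod_cast hT.trans_lt hTW
    obtain ⟨i₀, hi₀⟩ := hne
    have hf : τ ≤ f.accuracy := hacc i₀ hi₀ f (by simp [SQAlgorithm.queries])
    set W₁ := W.filter fun i => ¬ τ < |∫ x, f.toFun x ∂(D i) - c f| with hW₁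
    have hans : ∀ i ∈ W₁, adversarialOracle c (D i) f = c f := by
      intro i hi
      have h1 := not_lt.1 (Finset.mem_filter.1 hi).2
      rw [adversarialOracle, if_pos]
      rw [abs_sub_comm]
      exact h1.trans hf
    have hcard : (W.card : ℝ) - K ≤ W₁.card := by
      have h1 := Finset.card_filter_add_card_filter_not (s := W)
        (fun i => τ < |∫ x, f.toFun x ∂(D i) - c f|)
      have h2 : ((W.filter fun i => τ < |∫ x, f.toFun x ∂(D i) - c f|).card : ℝ) ≤ K :=
        le_trans (by
          exact_mod_cast Finset.card_le_card
            (Finset.filter_subset_filter _ (Finset.subset_univ W))) (hK f)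
      have h3 : ((W.filter fun i => τ < |∫ x, f.toFun x ∂(D i) - c f|).card : ℝ) + W₁.card =
        W.card := by exact_mod_cast h1
      linarith
    have hTK : 0 ≤ T - K := by
      have := hlen i₀ hi₀
      simp only [SQAlgorithm.queries, List.length_cons, Nat.cast_add, Nat.cast_one] at this
      nlinarith [mul_nonneg hK0 (Nat.cast_nonneg (α := ℝ)
        ((next (adversarialOracle c (D i₀) f)).queries (adversarialOracle c (D i₀))).length)]
    -- Each query loses at most K members of W and spends K of the budget T, so |W| - T does not
    -- decrease.
    have h := ih (c f) W₁ (T - K) hTK (by linarith) (by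
        intro i hi g hg
        refine hacc i (Finset.mem_filter.1 hi).1 g ?_
        rw [SQAlgorithm.queries, hans i hi]
        exact List.mem_cons_of_mem _ hg) (by
        intro i hi
        have := hlen i (Finset.mem_filter.1 hi).1
        rw [SQAlgorithm.queries, hans i hi] at this
        simp only [List.length_cons, Nat.cast_add, Nat.cast_one] at this
        linarith)
    have hsub : (W₁.filter fun i => (next (c f)).run (adversarialOracle c (D i)) =
        (next (c f)).run c) ⊆ W.filter fun i =>
          (SQAlgorithm.query f next).run (adversarialOracle c (D i)) =
            (SQAlgorithm.query f next).run c := by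
      intro i hi
      obtain ⟨hi1, hi2⟩ := Finset.mem_filter.1 hi
      refine Finset.mem_filter.2 ⟨(Finset.mem_filter.1 hi1).1, ?_⟩
      rw [SQAlgorithm.run, SQAlgorithm.run, hans i hi1]
      exact hi2
    have h5 : ((W₁.filter fun i => (next (c f)).run (adversarialOracle c (D i)) =
        (next (c f)).run c).card : ℝ) ≤ (W.filter fun i =>
          (SQAlgorithm.query f next).run (adversarialOracle c (D i)) =
            (SQAlgorithm.query f next).run c).card := by
      exact_mod_cast Finset.card_le_card hsub
    linarith

open Classical in
-- The expected number of i with ω ∈ S i is at least q |ι|, so some ω attains it. This fixes the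
-- seed of the randomized algorithm.
lemma exists_card_filter_mem_ge {Ω ι : Type*} [MeasurableSpace Ω] [Fintype ι] (P : Measure Ω)
    [IsProbabilityMeasure P] {S : ι → Set Ω} (hS : ∀ i, MeasurableSet (S i)) {q : ℝ}
    (hP : ∀ i, q ≤ P.real (S i)) :
    ∃ ω, q * Fintype.card ι ≤ ((Finset.univ.filter fun i => ω ∈ S i).card : ℝ) := by
  have hInt : ∀ i, Integrable ((S i).indicator fun _ => (1 : ℝ)) P := fun i =>
    (integrable_const 1).indicator (hS i)
  obtain ⟨ω, hω⟩ := exists_integral_le (μ := P)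
    (f := fun ω => ∑ i, (S i).indicator (fun _ => (1 : ℝ)) ω)
    (integrable_finsetSum _ fun i _ => hInt i)
  refine ⟨ω, ?_⟩
  rw [integral_finsetSum _ fun i _ => hInt i] at hω
  have h1 : ∑ i : ι, q ≤ ∑ i, ∫ ω, (S i).indicator (fun _ => (1 : ℝ)) ω ∂P := by
    refine Finset.sum_le_sum fun i _ => ?_
    rw [integral_indicator_const _ (hS i)]
    simpa using hP i
  have h2 : ∑ i, (S i).indicator (fun _ => (1 : ℝ)) ω =
      ((Finset.univ.filter fun i => ω ∈ S i).card : ℝ) := by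
    simp [Set.indicator_apply]
  rw [Finset.sum_const, nsmul_eq_mul, Finset.card_univ] at h1
  rw [h2] at hω
  linarith

instance measurableSingletonClass_units_int : MeasurableSingletonClass ℤˣ where
  measurableSet_singleton y :=
    ⟨{(y : ℤ)}, measurableSet_singleton _, by ext z; simp [Units.ext_iff]⟩

variable {m : ℕ} {A B : Measure ℝ}

lemma measurableSet_misclass (h : Hypothesis m) :
    MeasurableSet {z : Example m | h.1 z.1 ≠ z.2} :=
  (measurableSet_eq_fun (h.2.comp measurable_fst) measurable_snd).compl

/-- The indicator of misclassification, as a query. -/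
noncomputable def misclassQuery (h : Hypothesis m) : StatQuery (Example m) where
  toFun := Set.indicator {z | h.1 z.1 ≠ z.2} fun _ => 1
  measurable_toFun := measurable_const.indicator (measurableSet_misclass h)
  abs_le_one := by
    intro x
    by_cases hx : h.1 x.1 = x.2 <;> simp [hx]
  -- Any positive value would do: only the expectations of this query are used, and it is never put
  -- to an oracle.
  accuracy := 1
  accuracy_pos := one_pos

lemma integral_misclassQuery (h : Hypothesis m) (D : Measure (Example m)) :
    ∫ z, (misclassQuery h).toFun z ∂D = misclassError D h := by
  simp only [misclassQuery, misclassError]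
  rw [integral_indicator_const _ (measurableSet_misclass h)]
  simp

/-- With q the Gaussian probability that h = -1, the null error is p q + (1-p)(1-q), a convex
combination of p and 1-p. -/
lemma min_le_nullMean_misclassQuery {p : ℝ} (h : Hypothesis m) :
    min p (1 - p) ≤ nullMean p (misclassQuery h) := by
  set G := stdGaussian (EuclideanSpace ℝ (Fin m))
  have hms : MeasurableSet {x | h.1 x = -1} := h.2 (measurableSet_singleton _)
  have e1 : ∀ x, (misclassQuery h).toFun (x, 1) =
      ({x | h.1 x = -1} : Set _).indicator (fun _ => (1 : ℝ)) x := by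
    intro x
    rcases Int.units_eq_one_or (h.1 x) with hx | hx <;>
      simp [misclassQuery, hx]
  have e2 : ∀ x, (misclassQuery h).toFun (x, -1) =
      ({x | h.1 x = -1}ᶜ : Set _).indicator (fun _ => (1 : ℝ)) x := by
    intro x
    rcases Int.units_eq_one_or (h.1 x) with hx | hx <;>
      simp [misclassQuery, hx]
  rw [nullMean]
  simp_rw [e1, e2]
  rw [integral_indicator_const _ hms, integral_indicator_const _ hms.compl, smul_eq_mul,
    smul_eq_mul, mul_one, mul_one, probReal_compl_eq_one_sub hms]
  have h0 : 0 ≤ G.real {x | h.1 x = -1} := measureReal_nonneg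
  have h1 : G.real {x | h.1 x = -1} ≤ 1 := measureReal_le_one
  nlinarith [min_le_left p (1 - p), min_le_right p (1 - p)]

open Classical in
/-- A family of hidden directions that queries of accuracy `2√ρ` hardly distinguish from the null
distribution defeats every algorithm that makes few queries. -/
lemma not_achievesErrorBelow_of_card_distinguished_le {ι Ω : Type*} [Fintype ι]
    [MeasurableSpace Ω] {P : Measure Ω} [IsProbabilityMeasure P]
    {alg : Ω → SQAlgorithm (Example m) (Hypothesis m)} {p ρ K T : ℝ}
    {V : ι → EuclideanSpace ℝ (Fin m)} (hV : ∀ i, ‖V i‖ = 1) (hρ : 0 < ρ)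
    (hK : ∀ f : StatQuery (Example m), ((Finset.univ.filter fun i => 2 * √ρ <
      |∫ z, f.toFun z ∂(hiddenDirectionLabelled A B p (V i)) - nullMean p f|).card : ℝ) ≤ K)
    (hT : 0 ≤ T) (hTK : T + K < 2 / 3 * Fintype.card ι)
    (hacc : ∀ L, IsQueryTranscript alg A B p L → ∀ f ∈ L, 2 * √ρ ≤ f.accuracy)
    (hlen : ∀ L, IsQueryTranscript alg A B p L → K * L.length ≤ T) :
    ¬ AchievesErrorBelow P alg A B p (min p (1 - p) - 4 * √ρ) := by
  intro hach
  have hsρ : 0 < √ρ := Real.sqrt_pos.2 hρ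
  set O := fun i => adversarialOracle (nullMean p) (hiddenDirectionLabelled A B p (V i)) with hO
  have hvalid : ∀ i, IsSQOracle (hiddenDirectionLabelled A B p (V i)) (O i) := fun i =>
    isSQOracle_adversarialOracle _ _
  choose S hSm hSP hS using fun i => hach (V i) (hV i) (O i) (hvalid i)
  have hSP' : ∀ i, (2 / 3 : ℝ) ≤ P.real (S i) := by
    intro i
    have := ENNReal.toReal_mono (measure_ne_top P _) (hSP i)
    simpa [measureReal_def] using this
  obtain ⟨ω, hω⟩ := exists_card_filter_mem_ge P hSm hSP'
  have htr : ∀ i, IsQueryTranscript alg A B p ((alg ω).queries (O i)) := fun i =>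
    ⟨ω, V i, O i, hV i, hvalid i, rfl⟩
  set W := Finset.univ.filter fun i => ω ∈ S i with hW
  have hK0 : 0 ≤ K := (Nat.cast_nonneg _).trans (hK (misclassQuery ⟨fun _ => 1, measurable_const⟩))
  have hrun := SQAlgorithm.card_run_eq hK (alg ω) W T hT (by linarith)
    (fun i _ => hacc _ (htr i)) (fun i _ => hlen _ (htr i))
  set h := (alg ω).run (nullMean p) with hh
  -- On these directions h has error below min(p, 1-p) - 4√ρ, against at least min(p, 1-p) under the
  -- null. Its misclassification query therefore separates all of them, so there are at most K,
  -- while `hrun` gives at least |W| - T.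
  have hsub : (W.filter fun i => (alg ω).run (O i) = h) ⊆ Finset.univ.filter fun i => 2 * √ρ <
      |∫ z, (misclassQuery h).toFun z ∂(hiddenDirectionLabelled A B p (V i)) -
        nullMean p (misclassQuery h)| := by
    intro i hi
    obtain ⟨hi1, hi2⟩ := Finset.mem_filter.1 hi
    have herr := hS i ω (Finset.mem_filter.1 hi1).2
    rw [hi2] at herr
    refine Finset.mem_filter.2 ⟨Finset.mem_univ _, ?_⟩
    rw [integral_misclassQuery, lt_abs]
    right
    have := min_le_nullMean_misclassQuery (p := p) h
    linarith
  have hfin : ((W.filter fun i => (alg ω).run (O i) = h).card : ℝ) ≤ K :=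
    le_trans (by exact_mod_cast Finset.card_le_card hsub) (hK (misclassQuery h))
  have hrun' : (W.card : ℝ) - T ≤ (W.filter fun i => (alg ω).run (O i) = h).card := by
    convert hrun
  linarith

end Adversary

/-! ### Sign vectors and Hoeffding's inequality -/

section SignVectors

variable {m : ℕ}

/-- The sign `±1` encoded by a Boolean. -/
def boolSign (b : Bool) : ℝ := if b then 1 else -1

lemma boolSign_eq (b : Bool) : boolSign b = 1 ∨ boolSign b = -1 := by
  cases b <;> simp [boolSign]

/-- The unit vectors `ε / √m` with `ε ∈ {-1, 1}ᵐ`. -/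
noncomputable def signVector (σ : Fin m → Bool) : EuclideanSpace ℝ (Fin m) :=
  WithLp.toLp 2 fun i => boolSign (σ i) / √m

lemma inner_signVector (σ τ : Fin m → Bool) :
    inner ℝ (signVector σ) (signVector τ) = (∑ i, boolSign (σ i) * boolSign (τ i)) / m := by
  rw [PiLp.inner_apply, Finset.sum_div]
  refine Finset.sum_congr rfl fun i _ => ?_
  have hm : √(m : ℝ) * √m = m := Real.mul_self_sqrt (Nat.cast_nonneg m)
  change boolSign (τ i) / √m * (boolSign (σ i) / √m) = _
  rw [div_mul_div_comm, hm, mul_comm]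

lemma norm_signVector (hm : 1 ≤ m) (σ : Fin m → Bool) : ‖signVector σ‖ = 1 := by
  have hm0 : (m : ℝ) ≠ 0 := by positivity
  have h : ∀ i, boolSign (σ i) * boolSign (σ i) = 1 := fun i => by
    rcases boolSign_eq (σ i) with h | h <;> simp [h]
  have h1 : ‖signVector σ‖ ^ 2 = 1 := by
    rw [← real_inner_self_eq_norm_sq, inner_signVector]
    simp [h, hm0]
  exact (pow_eq_one_iff_of_nonneg (norm_nonneg _) two_ne_zero).1 h1

lemma sum_exp_signs {a : Fin m → ℝ} (ha : ∀ i, a i = 1 ∨ a i = -1) (η : ℝ) :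
    ∑ τ : Fin m → Bool, Real.exp (η * ∑ i, a i * boolSign (τ i)) = (2 * Real.cosh η) ^ m := by
  have h := Finset.prod_univ_sum (fun _ : Fin m => (Finset.univ : Finset Bool))
    (fun i b => Real.exp (η * (a i * boolSign b)))
  rw [Fintype.piFinset_univ] at h
  simp_rw [Finset.mul_sum, Real.exp_sum]
  rw [← h]
  refine (Finset.prod_congr rfl fun i _ => ?_).trans
    (Fin.prod_const m (2 * Real.cosh η))
  rw [Real.cosh_eq]
  rcases ha i with h | h <;> simp [h, boolSign] <;> ring

/-- Hoeffding's inequality for sums of independent signs, in counting form. -/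
lemma card_lt_sum_signs_le {a : Fin m → ℝ} (ha : ∀ i, a i = 1 ∨ a i = -1) {η : ℝ} (hη : 0 ≤ η) :
    ((Finset.univ.filter fun τ : Fin m → Bool => m * η < ∑ i, a i * boolSign (τ i)).card : ℝ) ≤
      2 ^ m * Real.exp (-(m * η ^ 2 / 2)) := by
  set S := Finset.univ.filter fun τ : Fin m → Bool => m * η < ∑ i, a i * boolSign (τ i) with hS
  -- Chernoff bound with exponential parameter η, the minimizer of the exponent m t²/2 - m t η.
  have h1 : (S.card : ℝ) * Real.exp (m * η ^ 2) ≤ (2 * Real.cosh η) ^ m := by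
    rw [← sum_exp_signs ha η, ← nsmul_eq_mul]
    refine (Finset.card_nsmul_le_sum S
      (fun τ => Real.exp (η * ∑ i, a i * boolSign (τ i))) _ fun τ hτ => ?_).trans
      (Finset.sum_le_sum_of_subset_of_nonneg (Finset.subset_univ S)
        fun _ _ _ => (Real.exp_pos _).le)
    have := (Finset.mem_filter.1 hτ).2.le
    refine Real.exp_le_exp.2 ?_
    nlinarith
  have h2 : (2 * Real.cosh η) ^ m ≤ 2 ^ m * Real.exp (m * η ^ 2 / 2) := by
    rw [mul_pow, mul_div_assoc, Real.exp_nat_mul]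
    gcongr
    exact Real.cosh_le_exp_half_sq η
  have e : Real.exp (-(m * η ^ 2 / 2)) = Real.exp (m * η ^ 2 / 2) / Real.exp (m * η ^ 2) := by
    rw [← Real.exp_sub]; congr 1; ring
  rw [e, ← mul_div_assoc, le_div_iff₀ (Real.exp_pos _)]
  exact h1.trans h2

lemma card_lt_abs_inner_signVector_le (hm : 1 ≤ m) (σ : Fin m → Bool) {η : ℝ} (hη : 0 ≤ η) :
    ((Finset.univ.filter fun τ => η < |inner ℝ (signVector σ) (signVector τ)|).card : ℝ) ≤
      2 * (2 ^ m * Real.exp (-(m * η ^ 2 / 2))) := by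
  have hm0 : (0 : ℝ) < m := by exact_mod_cast hm
  have h1 := card_lt_sum_signs_le (a := fun i => boolSign (σ i)) (fun i => boolSign_eq _) hη
  have h2 := card_lt_sum_signs_le (a := fun i => -boolSign (σ i)) (fun i => by
    rcases boolSign_eq (σ i) with h | h <;> simp [h]) hη
  set S := Finset.univ.filter fun τ : Fin m → Bool =>
    m * η < ∑ i, boolSign (σ i) * boolSign (τ i)
  set S' := Finset.univ.filter fun τ : Fin m → Bool =>
    m * η < ∑ i, -boolSign (σ i) * boolSign (τ i)
  have hsub : (Finset.univ.filter fun τ => η < |inner ℝ (signVector σ) (signVector τ)|) ⊆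
      S ∪ S' := by
    intro τ hτ
    have h := (Finset.mem_filter.1 hτ).2
    rw [inner_signVector, abs_div, abs_of_pos hm0, lt_div_iff₀ hm0, lt_abs, mul_comm] at h
    simpa [S, S', Finset.sum_neg_distrib] using h
  have h3 : ((Finset.univ.filter fun τ =>
      η < |inner ℝ (signVector σ) (signVector τ)|).card : ℝ) ≤ S.card + S'.card := by
    exact_mod_cast (Finset.card_le_card hsub).trans (Finset.card_union_le _ _)
  linarith

end SignVectors

/-! ### The two regimes and the choice of constants -/

section LowerBound

variable {m : ℕ} {A B : Measure ℝ}

/-- By Cauchy–Schwarz every query deviates from its null mean by at most √α ≤ 2√ρ. No query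
separates even one direction, so K = T = 0 works for a one-element family whatever the number of
queries; this includes α = 0. -/
lemma not_achievesErrorBelow_of_le_four_mul [IsProbabilityMeasure A] [IsProbabilityMeasure B]
    {Ω : Type*} [MeasurableSpace Ω] {P : Measure Ω} [IsProbabilityMeasure P]
    {alg : Ω → SQAlgorithm (Example m) (Hypothesis m)} {p ρ α : ℝ} (hm : 1 ≤ m) (hρ : 0 < ρ)
    (hp : 0 ≤ p) (hp1 : p ≤ 1)
    (hA : chiSqDiv A (gaussianReal 0 1) ≠ ∞) (hB : chiSqDiv B (gaussianReal 0 1) ≠ ∞)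
    (hAα : (chiSqDiv A (gaussianReal 0 1)).toReal ≤ α)
    (hBα : (chiSqDiv B (gaussianReal 0 1)).toReal ≤ α) (hα : α ≤ 4 * ρ)
    (hacc : ∀ L, IsQueryTranscript alg A B p L → ∀ f ∈ L, 2 * √ρ ≤ f.accuracy) :
    ¬ AchievesErrorBelow P alg A B p (min p (1 - p) - 4 * √ρ) := by
  have hV : ∀ i : Unit, ‖(EuclideanSpace.single (⟨0, hm⟩ : Fin m) (1 : ℝ))‖ = 1 := by simp
  refine not_achievesErrorBelow_of_card_distinguished_le (K := 0) (T := 0) hV hρ ?_ le_rfl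
    (by simp) hacc (by simp)
  intro f
  have h := abs_sum_integral_sub_nullMean_le hp hp1 hA hB hV f Finset.univ (M := α)
    (by simpa using
      (inner_liftDirection_centeredDensityLp_le_chiSqDiv hA (hV ()) (hV ())).trans hAα)
    (by simpa using
      (inner_liftDirection_centeredDensityLp_le_chiSqDiv hB (hV ()) (hV ())).trans hBα)
  have hs : √α ≤ 2 * √ρ := by
    calc √α ≤ √(2 ^ 2 * ρ) := Real.sqrt_le_sqrt (by linarith)
      _ = 2 * √ρ := by rw [Real.sqrt_mul (by norm_num), Real.sqrt_sq (by norm_num)]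
  simp only [Finset.univ_unique, Finset.sum_singleton] at h
  rw [Finset.filter_false_of_mem]
  · simp
  · intro i _
    exact not_lt.2 (h.trans hs)

/-- Here Eρ/α plays the role of N. With b = 2 · 2^m · x bounding the bad pairs per row and K =
2bα/(3ρ), at most N queries cost at most T = (2/3) b E, and α ≤ Eρ bounds K by the same number. The
hypothesis on E says 2bE < 2^m, so T + K < (2/3) 2^m. -/
lemma not_achievesErrorBelow_of_signVector [IsProbabilityMeasure A] [IsProbabilityMeasure B]
    {Ω : Type*} [MeasurableSpace Ω] {P : Measure Ω} [IsProbabilityMeasure P]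
    {alg : Ω → SQAlgorithm (Example m) (Hypothesis m)} {k : ℕ} {p ν ρ c α E : ℝ} (hm : 1 ≤ m)
    (hν : 0 ≤ ν) (hρ : 0 < ρ) (hc : 0 ≤ c) (hc1 : c ≤ 1) (hp : 0 ≤ p) (hp1 : p ≤ 1)
    (hkA : MatchesGaussianMoments k ν A) (hkB : MatchesGaussianMoments k ν B)
    (hA : chiSqDiv A (gaussianReal 0 1) ≠ ∞) (hB : chiSqDiv B (gaussianReal 0 1) ≠ ∞)
    (hAα : (chiSqDiv A (gaussianReal 0 1)).toReal ≤ α)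
    (hBα : (chiSqDiv B (gaussianReal 0 1)).toReal ≤ α)
    (hα0 : 0 ≤ α) (hαρ : ν ^ 2 + α * c ^ k ≤ ρ) (hαE : α ≤ E * ρ)
    (hE : 4 * E < Real.exp (m * (c / 8) ^ 2 / 2))
    (hacc : ∀ L, IsQueryTranscript alg A B p L → ∀ f ∈ L, 2 * √ρ ≤ f.accuracy)
    (hlen : ∀ L, IsQueryTranscript alg A B p L → L.length * α ≤ E * ρ) :
    ¬ AchievesErrorBelow P alg A B p (min p (1 - p) - 4 * √ρ) := by
  set x := Real.exp (-(m * (c / 8) ^ 2 / 2)) with hx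
  have hx0 : 0 < x := Real.exp_pos _
  have hxE : 4 * E * x < 1 := by
    have : x * Real.exp (m * (c / 8) ^ 2 / 2) = 1 := by rw [hx, ← Real.exp_add]; simp
    nlinarith
  have hE0 : 0 ≤ E := nonneg_of_mul_nonneg_left (hα0.trans hαE) hρ
  have hck : 0 ≤ c ^ k := pow_nonneg hc k
  set b : ℝ := 2 * (2 ^ m * x) with hb
  have hb0 : 0 ≤ b := by positivity
  have hKE : ∀ y : ℝ, y * α ≤ E * ρ → 2 * (b * α / (3 * ρ)) * y ≤ 2 / 3 * (b * E) := by
    intro y hy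
    have e : 2 * (b * α / (3 * ρ)) * y = 2 / 3 * b * (y * α) / ρ := by field_simp
    rw [e, div_le_iff₀ hρ]
    have : 2 / 3 * b * (y * α) ≤ 2 / 3 * b * (E * ρ) := by gcongr
    linarith
  refine not_achievesErrorBelow_of_card_distinguished_le (fun σ => norm_signVector hm σ) hρ
    (T := 2 / 3 * (b * E))
    (fun f => card_distinguished_le (η := c / 8) hp hp1 hA hB hρ hα0 hb0
      (fun σ => norm_signVector hm σ)
      (fun σ => ?_) hAα hBα (fun i j hij => ?_) (fun i j hij => ?_) f)
    (by positivity) ?_ hacc (fun L hL => hKE _ (hlen L hL))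
  · convert card_lt_abs_inner_signVector_le hm σ (η := c / 8) (by positivity)
  · refine (inner_liftDirection_centeredDensityLp_le hν hc hc1 hA hkA _ _ hij).trans ?_
    nlinarith
  · refine (inner_liftDirection_centeredDensityLp_le hν hc hc1 hB hkB _ _ hij).trans ?_
    nlinarith
  · have h1 := hKE 1 (by linarith)
    have h2 : (0 : ℝ) < 2 ^ m := by positivity
    simp only [Fintype.card_pi, Fintype.card_bool, Finset.prod_const, Finset.card_univ,
      Fintype.card_fin, Nat.cast_pow, Nat.cast_ofNat]
    have h3 : b * E * 2 < 2 ^ m := by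
      rw [hb]
      nlinarith
    linarith

end LowerBound

theorem lemma4p3 :
    ∃ C : ℝ, 0 < C ∧
      ∀ (m k : ℕ) (ν ρ c p : ℝ) (A B : Measure ℝ)
        [IsProbabilityMeasure A] [IsProbabilityMeasure B] (α : ℝ≥0∞),
        1 ≤ m → 0 < ν → 0 < ρ → 0 < c → 0 < p → p < 1 →
        MatchesGaussianMoments k ν A → MatchesGaussianMoments k ν B →
        chiSqDiv A (gaussianReal 0 1) ≠ ∞ → chiSqDiv B (gaussianReal 0 1) ≠ ∞ →
        α = chiSqDiv A (gaussianReal 0 1) + chiSqDiv B (gaussianReal 0 1) →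
        ν ^ 2 + α.toReal * c ^ k ≤ ρ →
        ∀ (Ω : Type*) [MeasurableSpace Ω] (P : Measure Ω) [IsProbabilityMeasure P]
          (alg : Ω → SQAlgorithm (Example m) (Hypothesis m)),
          AchievesErrorBelow P alg A B p (min p (1 - p) - 4 * √ρ) →
          -- a bound by a number `N < 1` carries no information
          1 ≤ queryBound C c m ρ α →
          (∃ L, IsQueryTranscript alg A B p L ∧ ∃ f ∈ L, f.accuracy < 2 * √ρ) ∨
          (∃ L, IsQueryTranscript alg A B p L ∧ queryBound C c m ρ α ≤ (L.length : ℝ≥0∞)) := by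
  -- The Hoeffding exponent at c/8 is m c²/128. Half of it goes to N; the other half absorbs the
  -- factor 4 in the counting.
  refine ⟨1 / 256, by norm_num, ?_⟩
  intro m k ν ρ c p A B _ _ α hm hν hρ hc hp hp1 hkA hkB hA hB hα hαρ Ω _ P _ alg hach hN
  by_contra! hcon
  obtain ⟨hacc, hlen⟩ := hcon
  have hαtop : α ≠ ∞ := by rw [hα]; finiteness
  have hsum : α.toReal = (chiSqDiv A (gaussianReal 0 1)).toReal +
      (chiSqDiv B (gaussianReal 0 1)).toReal := by
    rw [hα, ENNReal.toReal_add hA hB]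
  have hA0 : 0 ≤ (chiSqDiv A (gaussianReal 0 1)).toReal := ENNReal.toReal_nonneg
  have hB0 : 0 ≤ (chiSqDiv B (gaussianReal 0 1)).toReal := ENNReal.toReal_nonneg
  rcases le_or_gt α.toReal (4 * ρ) with h4 | h4
  · exact not_achievesErrorBelow_of_le_four_mul hm hρ hp.le hp1.le hA hB (by linarith)
      (by linarith) h4 hacc hach
  have hα0 : 0 < α.toReal := by linarith
  have hαne : α ≠ 0 := fun h => by simp [h] at hα0
  -- Otherwise c^k ≥ 1 and α ≤ ρ, contrary to α > 4ρ.
  have hc1 : c ≤ 1 := by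
    by_contra! hc1
    have : 1 ≤ c ^ k := one_le_pow₀ hc1.le
    nlinarith [sq_nonneg ν]
  set E : ℝ := (2 : ℝ) ^ (1 / 256 * c ^ 2 * (m : ℝ)) with hE
  have hE0 : 0 < E := by positivity
  have hbound : ∀ n : ℕ, (n : ℝ≥0∞) ≤ queryBound (1 / 256) c m ρ α → n * α.toReal ≤ E * ρ := by
    intro n hn
    rw [queryBound, ENNReal.le_div_iff_mul_le (Or.inl hαne) (Or.inl hαtop)] at hn
    have := ENNReal.toReal_mono ENNReal.ofReal_ne_top hn
    rwa [ENNReal.toReal_mul, ENNReal.toReal_natCast,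
      ENNReal.toReal_ofReal (by positivity)] at this
  -- This is where N ≥ 1 enters. With α > 4ρ it gives E > 4, hence 4E < E², which the Hoeffding
  -- exponential dominates.
  have hαE : α.toReal ≤ E * ρ := by simpa using hbound 1 (by simpa using hN)
  have hE4 : 4 < E := lt_of_mul_lt_mul_right (h4.trans_le hαE) hρ.le
  have hEE : E * E ≤ Real.exp (m * (c / 8) ^ 2 / 2) := by
    rw [hE, Real.rpow_def_of_pos two_pos, ← Real.exp_add]
    refine Real.exp_le_exp.2 ?_
    have hl : Real.log 2 ≤ 1 := by linarith [Real.log_two_lt_d9]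
    have : 0 ≤ c ^ 2 * (m : ℝ) := by positivity
    nlinarith
  exact not_achievesErrorBelow_of_signVector hm hν.le hρ hc.le hc1 hp.le hp1.le hkA hkB hA hB
    (by linarith) (by linarith) hα0.le hαρ hαE (by nlinarith) hacc
    (fun L hL => hbound _ (hlen L hL).le) hach
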